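/- Let $\mathcal D=\{[n2^{-k},(n+1)2^{-k}):n,k\in\mathbb Z\}$ be the dyadic intervals of $\mathbb R$. For $I\in\mathcal D$ with left and right halves $I_-,I_+$ put $h_I=|I|^{-1/2}(\mathbf 1_{I_+}-\mathbf 1_{I_-})$, and for a locally integrable $f$ put $f(I,0)=\int_{\mathbb R} f h_I\,dx$ and $f(I,1)=\frac1{|I|}\int_I f\,dx$. Functions and symbols are scalar valued (all real, or all complex). For $\alpha=(\alpha_1,\dots,\alpha_m)\in\{0,1\}^m$ let $\sigma(\alpha)=\#\{j:\alpha_j=0\}$, and let $U_m=\{0,1\}^m\setminus\{(1,\dots,1)\}$. For a family of scalars $\epsilon=\{\epsilon_I\}_{I\in\mathcal D}$ define the $m$-linear Haar multiplier $$T^{\alpha}_\epsilon(f_1,\dots,f_m)=\sum_{I\in\mathcal D}\epsilon_I\Big(\prod_{j=1}^m f_j(I,\alpha_j)\Big)h_I^{\sigma(\alpha)},$$ where the series is summed unconditionally with respect to convergence in Lebesgue measure, i.e. its value is the limit in measure of the sums over finite sets of dyadic intervals, along the directed set of all such finite sets. For $0<r<\infty$ let $\|g\|_r=(\int_{\mathbb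 R}|g|^r\,dx)^{1/r}$ and $\|g\|_{L^{r,\infty}}=\sup_{t>0}t\,|\{x\in\mathbb R:|g(x)|>t\}|^{1/r}$. **Theorem.** Let $\epsilon=\{\epsilon_I\}_{I\in\mathcal D}$ be given, let $\alpha\in U_m$, and let $\sum_{j=1}^m\frac1{p_j}=\frac1r$. 1. If $1<p_1,\dots,p_m<\infty$, then $T^\alpha_\epsilon$ is bounded from $L^{p_1}(\mathbb R)\times\cdots\times L^{p_m}(\mathbb R)$ to $L^r(\mathbb R)$ if and only if $\|\epsilon\|_\infty:=\sup_{I\in\mathcal D}|\epsilon_I|<\infty$. Here bounded means that there is a finite constant $C$ such that for all $f_j\in L^{p_j}$ the series defining $T^\alpha_\epsilon(f_1,\dots,f_m)$ converges, and $\|T^\alpha_\epsilon(f_1,\dots,f_m)\|_r\le C\prod_{j=1}^m\|f_j\|_{p_j}$. 2. If $1\le p_1,\dots,p_m<\infty$ and $\|\epsilon\|_\infty<\infty$, then $T^\alpha_\epsilon$ is bounded from $L^{p_1}(\mathbb R)\times\cdots\times L^{p_m}(\mathbb R)$ to $L^{r,\infty}(\mathbb R)$: there is a finite constant $C$ such that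 for all $f_j\in L^{p_j}$ the series converges, and $\|T^\alpha_\epsilon(f_1,\dots,f_m)\|_{L^{r,\infty}}\le C\prod_{j=1}^m\|f_j\|_{p_j}$. -/

import Mathlib

open MeasureTheory Filter
open scoped ENNReal NNReal

namespace MultilinearHaar

/-- The standard dyadic grid on the line: the pair `(n, k)` of integers stands for the dyadic
interval `[n 2^{-k}, (n+1) 2^{-k})`; distinct pairs give distinct intervals
(see `DyadicInterval.toSet_injective`). -/
structure DyadicInterval where
  index : ℤ
  scale : ℤ

namespace DyadicInterval

/-- The length `|I| = 2^{-k}`. -/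
noncomputable def len (I : DyadicInterval) : ℝ := (2 : ℝ) ^ (-I.scale)

/-- The left end point `n 2^{-k}`. -/
noncomputable def left (I : DyadicInterval) : ℝ := (I.index : ℝ) * I.len

/-- The interval itself, `[n 2^{-k}, (n+1) 2^{-k})`. -/
def toSet (I : DyadicInterval) : Set ℝ := Set.Ico I.left (I.left + I.len)

/-- The left half `I_-`. -/
def leftHalf (I : DyadicInterval) : Set ℝ := Set.Ico I.left (I.left + I.len / 2)

/-- The right half `I_+`. -/
def rightHalf (I : DyadicInterval) : Set ℝ := Set.Ico (I.left + I.len / 2) (I.left + I.len)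

theorem len_pos (I : DyadicInterval) : 0 < I.len := by
  unfold len; positivity

theorem toSet_injective : Function.Injective toSet := by
  rintro I J h
  have hI := I.len_pos
  have hJ := J.len_pos
  unfold toSet at h
  have hl : I.left = J.left := by
    have := congrArg sInf h
    rwa [csInf_Ico (by linarith), csInf_Ico (by linarith)] at this
  have hr : I.left + I.len = J.left + J.len := by
    have := congrArg sSup h
    rwa [csSup_Ico (by linarith), csSup_Ico (by linarith)] at this
  have hlen : I.len = J.len := by linarith
  have hs : -I.scale = -J.scale :=
    zpow_right_injective₀ (by norm_num : (0 : ℝ) < 2) (by norm_num) hlen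
  have hn : (I.index : ℝ) = J.index := by
    unfold left at hl
    rw [hlen] at hl
    exact mul_right_cancel₀ hJ.ne' hl
  cases I; cases J
  simp only [mk.injEq]
  exact ⟨by exact_mod_cast hn, by simpa using hs⟩

end DyadicInterval

/-- The Haar function `h_I = |I|^{-1/2} (1_{I_+} - 1_{I_-})`. -/
noncomputable def haar (I : DyadicInterval) (x : ℝ) : ℝ :=
  (Real.sqrt I.len)⁻¹ *
    (I.rightHalf.indicator (fun _ => (1 : ℝ)) x - I.leftHalf.indicator (fun _ => (1 : ℝ)) x)

section

variable {𝕜 : Type*} [RCLike 𝕜]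

/-- `f(I, 0) = ⟨f, h_I⟩ = ∫ f h_I`, the Haar coefficient, and
`f(I, 1) = |I|⁻¹ ∫_I f`, the average of `f` over `I`. -/
noncomputable def coeff (f : ℝ → 𝕜) (I : DyadicInterval) (a : Fin 2) : 𝕜 :=
  if a = 0 then ∫ x, f x * (haar I x : 𝕜)
  else ((I.len : ℝ) : 𝕜)⁻¹ * ∫ x in I.toSet, f x

/-- `U_m = {0,1}^m \ {(1,…,1)}`. -/
def U (m : ℕ) : Set (Fin m → Fin 2) := {α | α ≠ fun _ => 1}

/-- `σ(α)`, the number of components of `α` that are `0`. -/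
def sigma {m : ℕ} (α : Fin m → Fin 2) : ℕ := (Finset.univ.filter fun j => α j = 0).card

/-- The term `ε_I (∏_j f_j(I, α_j)) h_I^{σ(α)}` of the series, a function on the line. -/
noncomputable def haarTerm {m : ℕ} (ε : DyadicInterval → 𝕜) (α : Fin m → Fin 2)
    (f : Fin m → ℝ → 𝕜) (I : DyadicInterval) (x : ℝ) : 𝕜 :=
  ε I * (∏ j, coeff (f j) I (α j)) * (haar I x : 𝕜) ^ sigma α

/-- `g = T_ε^α(f_1, …, f_m)`: the function `g` is the sum of the series
`∑_I ε_I (∏_j f_j(I, α_j)) h_I^{σ(α)}` over all dyadic intervals, the sums over finite sets of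
dyadic intervals converging to `g` in measure, unconditionally (along the directed set of all finite
sets of dyadic intervals). Such a `g` is unique up to null sets. -/
def IsHaarMultiplier {m : ℕ} (ε : DyadicInterval → 𝕜) (α : Fin m → Fin 2)
    (f : Fin m → ℝ → 𝕜) (g : ℝ → 𝕜) : Prop :=
  TendstoInMeasure volume
    (fun (F : Finset DyadicInterval) (x : ℝ) => ∑ I ∈ F, haarTerm ε α f I x) atTop g

/-- The quasi-norm of weak `L^r`, `sup_{t > 0} t |{x : |g(x)| > t}|^{1/r}`, for `0 < r < ∞`. -/
noncomputable def weakNorm (g : ℝ → 𝕜) (r : ℝ≥0∞) : ℝ≥0∞ :=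
  ⨆ t : ℝ≥0, (t : ℝ≥0∞) * volume {x | (t : ℝ) < ‖g x‖} ^ (1 / r.toReal)

/-- `T_ε^α` is bounded from `L^{p_1} × ⋯ × L^{p_m}` to `L^r`: it is defined on the whole product,
takes values in `L^r`, and `‖T_ε^α(f)‖_r ≤ C ∏_j ‖f_j‖_{p_j}`. -/
def StrongBounded {m : ℕ} (ε : DyadicInterval → 𝕜) (α : Fin m → Fin 2)
    (p : Fin m → ℝ≥0∞) (r : ℝ≥0∞) : Prop :=
  ∃ C : ℝ≥0, ∀ f : Fin m → ℝ → 𝕜, (∀ j, MemLp (f j) (p j) volume) →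
    ∃ g : ℝ → 𝕜, IsHaarMultiplier ε α f g ∧ MemLp g r volume ∧
      eLpNorm g r volume ≤ C * ∏ j, eLpNorm (f j) (p j) volume

/-- `T_ε^α` is of weak type, that is, bounded from `L^{p_1} × ⋯ × L^{p_m}` to `L^{r,∞}`. -/
def WeakBounded {m : ℕ} (ε : DyadicInterval → 𝕜) (α : Fin m → Fin 2)
    (p : Fin m → ℝ≥0∞) (r : ℝ≥0∞) : Prop :=
  ∃ C : ℝ≥0, ∀ f : Fin m → ℝ → 𝕜, (∀ j, MemLp (f j) (p j) volume) →
    ∃ g : ℝ → 𝕜, IsHaarMultiplier ε α f g ∧ AEStronglyMeasurable g volume ∧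
      weakNorm g r ≤ C * ∏ j, eLpNorm (f j) (p j) volume

/-- `‖ε‖_∞ = sup_I |ε_I|`, in `[0, ∞]`. -/
noncomputable def symbolNorm (ε : DyadicInterval → 𝕜) : ℝ≥0∞ := ⨆ I, ‖ε I‖ₑ

end

end MultilinearHaar

/-! Sufficiency rests on a good-λ inequality between two functions: the maximal partial sum
`maximalSum` of a finite piece of the series, with intervals added in order of decreasing length,
and the product of the dyadic maximal functions of the `f j`. Since `α` has a zero entry, every term
of the series vanishes off its interval and is constant on the halves, so partial sums are constant
on dyadic intervals and stopping-time arguments apply.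

The local estimate is `measure_lt_norm_sum_haarTerm_stopped_le`. Inside an interval `J`, keep only
intervals before the averages of `|f j|` exceed levels `t j`. A Bessel inequality, obtained by
telescoping the parallelogram law down the dyadic tree, gives square sums of Haar coefficients at
most `4 (t j)² |J|`. If exactly one `α j` is zero, orthogonality and Chebyshev in `L²` suffice; if
there are at least two, Cauchy–Schwarz and Chebyshev in `L¹` do. Applying this on the maximal
intervals where the partial sum exceeds `s` gives `exists_good_lambda`. As finite sums are bounded
with support of finite measure, the good-λ term can be absorbed, for every `0 < r < ∞`, in both weak
and strong form. Weak and strong bounds for the maximal function and Hölder's inequality then give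
estimates uniform over finite sets of intervals.

These uniform bounds also yield convergence. Approximate one `f i` with `α i = 0` by a compactly
supported dyadic step function. The error is controlled by the weak-type bound; for the step
function short intervals contribute nothing, very long ones contribute uniformly little, and only
finitely many others matter. Hence the net of finite sums is Cauchy in measure, and the bounds pass
to the limit.

For necessity, test on `h_I` in the cancellative places and `1_I` elsewhere: orthogonality leaves
one term of the series, and the norms on both sides agree up to `|ε_I|`. -/

namespace MultilinearHaar

/-! ### Geometry of the dyadic grid and covering by maximal intervals -/

namespace DyadicInterval

/-- The dyadic interval of length `2^{-k}` that contains `x`. -/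
noncomputable def cube (k : ℤ) (x : ℝ) : DyadicInterval := ⟨⌊x * 2 ^ k⌋, k⟩

@[simp] theorem cube_scale (k : ℤ) (x : ℝ) : (cube k x).scale = k := rfl

theorem len_ne_zero (I : DyadicInterval) : I.len ≠ 0 := I.len_pos.ne'

theorem mem_toSet_iff {I : DyadicInterval} {x : ℝ} : x ∈ I.toSet ↔ cube I.scale x = I := by
  have h2 : (0 : ℝ) < 2 ^ I.scale := by positivity
  have hlen : I.len = (2 ^ I.scale)⁻¹ := by simp [len, zpow_neg]
  obtain ⟨n, k⟩ := I
  simp only [cube, mk.injEq, and_true, Int.floor_eq_iff, toSet, left, hlen, Set.mem_Ico] at h2 ⊢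
  rw [← div_eq_mul_inv, div_le_iff₀ h2, ← one_div, ← add_div, lt_div_iff₀ h2]

theorem mem_cube (k : ℤ) (x : ℝ) : x ∈ (cube k x).toSet := mem_toSet_iff.2 rfl

/-- Nesting of the grid: the coarser index is the integer quotient of the finer one by a power of
two. -/
theorem cube_eq_of_le {j k : ℤ} (hjk : j ≤ k) {x y : ℝ} (h : cube k x = cube k y) :
    cube j x = cube j y := by
  obtain ⟨n, rfl⟩ := Int.le.dest hjk
  have key : ∀ z : ℝ, ⌊z * 2 ^ j⌋ = ⌊z * 2 ^ (j + (n : ℤ))⌋ / ((2 ^ n : ℕ) : ℤ) := by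
    intro z
    rw [← Int.floor_div_natCast]
    congr 1
    rw [zpow_add₀ (by norm_num)]
    push_cast
    rw [zpow_natCast]
    field_simp
  simp only [cube, mk.injEq, and_true] at h ⊢
  rw [key x, key y, h]

theorem left_mem (I : DyadicInterval) : I.left ∈ I.toSet :=
  ⟨le_rfl, lt_add_of_pos_right _ I.len_pos⟩

theorem eq_of_mem {I J : DyadicInterval} {x : ℝ} (hI : x ∈ I.toSet) (hJ : x ∈ J.toSet)
    (h : I.scale = J.scale) : I = J := by
  rw [← mem_toSet_iff.1 hI, ← mem_toSet_iff.1 hJ, h]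

theorem subset_of_mem {I J : DyadicInterval} {x : ℝ} (hI : x ∈ I.toSet) (hJ : x ∈ J.toSet)
    (h : J.scale ≤ I.scale) : I.toSet ⊆ J.toSet := by
  intro y hy
  rw [mem_toSet_iff] at *
  rw [← hJ, cube_scale]
  exact cube_eq_of_le h (hy.trans hI.symm)

theorem volume_toSet (I : DyadicInterval) : volume I.toSet = ENNReal.ofReal I.len := by
  simp [toSet]

theorem measurableSet_toSet (I : DyadicInterval) : MeasurableSet I.toSet := measurableSet_Ico

theorem volume_ne_zero (I : DyadicInterval) : volume I.toSet ≠ 0 := by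
  simp [volume_toSet, I.len_pos]

theorem volume_ne_top (I : DyadicInterval) : volume I.toSet ≠ ∞ := by
  simp [volume_toSet]

theorem len_le_len_iff {I J : DyadicInterval} : I.len ≤ J.len ↔ J.scale ≤ I.scale := by
  unfold len
  rw [zpow_le_zpow_iff_right₀ (by norm_num)]
  omega

theorem scale_le_of_subset {I J : DyadicInterval} (h : I.toSet ⊆ J.toSet) :
    J.scale ≤ I.scale := by
  rw [← len_le_len_iff, ← ENNReal.ofReal_le_ofReal_iff J.len_pos.le, ← volume_toSet,
    ← volume_toSet]
  exact measure_mono h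

theorem subset_or_disjoint (I J : DyadicInterval) :
    I.toSet ⊆ J.toSet ∨ J.toSet ⊆ I.toSet ∨ Disjoint I.toSet J.toSet := by
  by_cases h : Disjoint I.toSet J.toSet
  · exact Or.inr (Or.inr h)
  obtain ⟨x, hI, hJ⟩ := Set.not_disjoint_iff.1 h
  rcases le_total J.scale I.scale with hs | hs
  · exact Or.inl (subset_of_mem hI hJ hs)
  · exact Or.inr (Or.inl (subset_of_mem hJ hI hs))

/-- The dyadic interval `I_-`. -/
def leftChild (I : DyadicInterval) : DyadicInterval := ⟨2 * I.index, I.scale + 1⟩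

/-- The dyadic interval `I_+`. -/
def rightChild (I : DyadicInterval) : DyadicInterval := ⟨2 * I.index + 1, I.scale + 1⟩

theorem len_leftChild (I : DyadicInterval) : I.leftChild.len = I.len / 2 := by
  simp only [leftChild, len, neg_add, zpow_add₀ (two_ne_zero (α := ℝ))]
  norm_num [div_eq_mul_inv]

theorem len_rightChild (I : DyadicInterval) : I.rightChild.len = I.len / 2 := by
  simp only [rightChild, len, neg_add, zpow_add₀ (two_ne_zero (α := ℝ))]
  norm_num [div_eq_mul_inv]

theorem toSet_leftChild (I : DyadicInterval) : I.leftChild.toSet = I.leftHalf := by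
  have h : I.leftChild.left = I.left := by
    rw [left, len_leftChild, left, leftChild]; push_cast; ring
  rw [toSet, leftHalf, h, len_leftChild]

theorem toSet_rightChild (I : DyadicInterval) : I.rightChild.toSet = I.rightHalf := by
  have h : I.rightChild.left = I.left + I.len / 2 := by
    rw [left, len_rightChild, left, rightChild]; push_cast; ring
  rw [toSet, rightHalf, h, len_rightChild]
  congr 1; ring

theorem leftHalf_union_rightHalf (I : DyadicInterval) : I.leftHalf ∪ I.rightHalf = I.toSet := by
  have := I.len_pos
  exact Set.Ico_union_Ico_eq_Ico (by linarith) (by linarith)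

theorem disjoint_halves (I : DyadicInterval) : Disjoint I.leftHalf I.rightHalf := by
  rw [Set.disjoint_left]
  rintro x ⟨_, h⟩ ⟨h', _⟩
  linarith

theorem subset_child {I J : DyadicInterval} (h : I.toSet ⊆ J.toSet) (hs : J.scale < I.scale) :
    I.toSet ⊆ J.leftChild.toSet ∨ I.toSet ⊆ J.rightChild.toSet := by
  have hx := h I.left_mem
  rw [← leftHalf_union_rightHalf, ← toSet_leftChild, ← toSet_rightChild] at hx
  rcases hx with hx | hx
  · exact Or.inl (subset_of_mem I.left_mem hx hs)
  · exact Or.inr (subset_of_mem I.left_mem hx hs)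

theorem leftChild_subset (I : DyadicInterval) : I.leftChild.toSet ⊆ I.toSet := by
  rw [toSet_leftChild, ← leftHalf_union_rightHalf]; exact Set.subset_union_left

theorem rightChild_subset (I : DyadicInterval) : I.rightChild.toSet ⊆ I.toSet := by
  rw [toSet_rightChild, ← leftHalf_union_rightHalf]; exact Set.subset_union_right

theorem equivProd_injective :
    Function.Injective fun I : DyadicInterval => (I.index, I.scale) := by
  rintro ⟨a, b⟩ ⟨c, d⟩ h
  simpa using h

instance : Countable DyadicInterval := equivProd_injective.countable

/-- The inclusion-maximal members of `Q`. -/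
def maximals (Q : Set DyadicInterval) : Set DyadicInterval :=
  {I ∈ Q | ∀ J ∈ Q, I.toSet ⊆ J.toSet → J = I}

theorem pairwiseDisjoint_maximals (Q : Set DyadicInterval) :
    (maximals Q).PairwiseDisjoint toSet := by
  intro I hI J hJ hne
  rcases subset_or_disjoint I J with h | h | h
  · exact absurd (hI.2 J hJ.1 h).symm hne
  · exact absurd (hJ.2 I hI.1 h) hne
  · exact h

/-- Without a lower bound on the scales the members of `Q` could increase indefinitely and no
maximal one need exist. -/
theorem exists_maximals_superset {Q : Set DyadicInterval} {k₀ : ℤ} (hQ : ∀ I ∈ Q, k₀ ≤ I.scale)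
    {I : DyadicInterval} (hI : I ∈ Q) : ∃ J ∈ maximals Q, I.toSet ⊆ J.toSet := by
  obtain ⟨k, ⟨J, hJ, hIJ, rfl⟩, hk⟩ := Int.exists_least_of_bdd
    (P := fun k => ∃ J ∈ Q, I.toSet ⊆ J.toSet ∧ J.scale = k)
    ⟨k₀, by rintro z ⟨J, hJ, _, rfl⟩; exact hQ J hJ⟩ ⟨_, I, hI, subset_rfl, rfl⟩
  refine ⟨J, ⟨hJ, fun L hL hJL => ?_⟩, hIJ⟩
  exact eq_of_mem (hJL J.left_mem) J.left_mem
    (le_antisymm (scale_le_of_subset hJL) (hk _ ⟨L, hL, hIJ.trans hJL, rfl⟩))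

theorem biUnion_maximals {Q : Set DyadicInterval} {k₀ : ℤ} (hQ : ∀ I ∈ Q, k₀ ≤ I.scale) :
    ⋃ I ∈ maximals Q, I.toSet = ⋃ I ∈ Q, I.toSet := by
  apply subset_antisymm
  · exact Set.biUnion_subset_biUnion_left fun I hI => hI.1
  · refine Set.iUnion₂_subset fun I hI => ?_
    obtain ⟨J, hJ, h⟩ := exists_maximals_superset hQ hI
    exact h.trans (Set.subset_biUnion_of_mem (u := toSet) hJ)

/-- The maximal members are disjoint and have the same union as `Q`, so an inequality between
measures on each of them adds up. -/
theorem measure_biUnion_le_of_maximals {Q : Set DyadicInterval} {k₀ : ℤ}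
    (hQ : ∀ I ∈ Q, k₀ ≤ I.scale) {μ ν : Measure ℝ}
    (h : ∀ I ∈ maximals Q, μ I.toSet ≤ ν I.toSet) :
    μ (⋃ I ∈ Q, I.toSet) ≤ ν (⋃ I ∈ Q, I.toSet) := by
  rw [← biUnion_maximals hQ,
    measure_biUnion (Set.to_countable _) (pairwiseDisjoint_maximals Q)
      fun I _ => I.measurableSet_toSet,
    measure_biUnion (Set.to_countable _) (pairwiseDisjoint_maximals Q)
      fun I _ => I.measurableSet_toSet]
  exact ENNReal.tsum_le_tsum fun I => h I I.2

/-- The covering argument behind all weak-type bounds for the maximal function. Intervals of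
arbitrary length are reached by truncating the scales from below and using continuity of `μ` along
increasing unions. -/
theorem measure_biUnion_le {Q : Set DyadicInterval} {μ ν : Measure ℝ}
    (h : ∀ I ∈ Q, μ I.toSet ≤ ν I.toSet) :
    μ (⋃ I ∈ Q, I.toSet) ≤ ν (⋃ I ∈ Q, I.toSet) := by
  have hU : ⋃ I ∈ Q, I.toSet = ⋃ n : ℕ, ⋃ I ∈ {I ∈ Q | -(n : ℤ) ≤ I.scale}, I.toSet := by
    ext x
    simp only [Set.mem_iUnion, Set.mem_ofPred_eq, exists_prop]
    constructor
    · rintro ⟨I, hI, hx⟩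
      exact ⟨I.scale.natAbs, I, ⟨hI, by omega⟩, hx⟩
    · rintro ⟨n, I, ⟨hI, _⟩, hx⟩
      exact ⟨I, hI, hx⟩
  have hmono : Monotone fun n : ℕ => ⋃ I ∈ {I ∈ Q | -(n : ℤ) ≤ I.scale}, I.toSet := by
    intro a b hab
    refine Set.biUnion_subset_biUnion_left fun I hI => ⟨hI.1, ?_⟩
    have := hI.2
    omega
  conv_lhs => rw [hU]
  rw [hmono.measure_iUnion]
  refine iSup_le fun n => ?_
  refine (measure_biUnion_le_of_maximals (fun I hI => hI.2) fun I hI => h I hI.1.1).trans ?_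
  exact measure_mono (Set.biUnion_subset_biUnion_left fun I hI => hI.1)

end DyadicInterval

open DyadicInterval

/-! ### Haar functions and their orthogonality -/

theorem haar_eq_indicator (I : DyadicInterval) (x : ℝ) :
    haar I x = (Real.sqrt I.len)⁻¹ *
      (I.rightChild.toSet.indicator (fun _ => (1 : ℝ)) x
        - I.leftChild.toSet.indicator (fun _ => (1 : ℝ)) x) := by
  rw [toSet_rightChild, toSet_leftChild, haar]

theorem measurable_haar (I : DyadicInterval) : Measurable (haar I) := by
  unfold haar
  exact ((measurable_const.indicator measurableSet_Ico).sub
    (measurable_const.indicator measurableSet_Ico)).const_mul _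

theorem haar_of_mem_left {I : DyadicInterval} {x : ℝ} (hx : x ∈ I.leftHalf) :
    haar I x = -(Real.sqrt I.len)⁻¹ := by
  simp [haar, hx, Set.disjoint_left.1 I.disjoint_halves hx]

theorem haar_of_mem_right {I : DyadicInterval} {x : ℝ} (hx : x ∈ I.rightHalf) :
    haar I x = (Real.sqrt I.len)⁻¹ := by
  simp [haar, hx, Set.disjoint_right.1 I.disjoint_halves hx]

theorem haar_of_notMem {I : DyadicInterval} {x : ℝ} (hx : x ∉ I.toSet) : haar I x = 0 := by
  rw [← leftHalf_union_rightHalf, Set.mem_union, not_or] at hx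
  simp [haar, hx.1, hx.2]

theorem abs_haar_of_mem {I : DyadicInterval} {x : ℝ} (hx : x ∈ I.toSet) :
    |haar I x| = (Real.sqrt I.len)⁻¹ := by
  rw [← leftHalf_union_rightHalf] at hx
  rcases hx with hx | hx
  · rw [haar_of_mem_left hx, abs_neg, abs_of_nonneg (by positivity)]
  · rw [haar_of_mem_right hx, abs_of_nonneg (by positivity)]

theorem abs_haar (I : DyadicInterval) (x : ℝ) :
    |haar I x| = I.toSet.indicator (fun _ => (Real.sqrt I.len)⁻¹) x := by
  by_cases hx : x ∈ I.toSet
  · rw [Set.indicator_of_mem hx, abs_haar_of_mem hx]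
  · rw [Set.indicator_of_notMem hx, haar_of_notMem hx, abs_zero]

theorem abs_haar_le (I : DyadicInterval) (x : ℝ) : |haar I x| ≤ (Real.sqrt I.len)⁻¹ := by
  rw [abs_haar]
  exact Set.indicator_le_self' (fun _ _ => by positivity) x

theorem mem_toSet_congr {I : DyadicInterval} {k : ℤ} (hk : I.scale ≤ k) {x y : ℝ}
    (h : cube k x = cube k y) : x ∈ I.toSet ↔ y ∈ I.toSet := by
  rw [mem_toSet_iff, mem_toSet_iff, cube_eq_of_le hk h]

/-- The inequality is strict because the pieces of constancy are the children of `I`, whose scale is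
`I.scale + 1`. -/
theorem haar_congr {I : DyadicInterval} {k : ℤ} (hk : I.scale < k) {x y : ℝ}
    (h : cube k x = cube k y) : haar I x = haar I y := by
  rw [haar_eq_indicator, haar_eq_indicator]
  congr 2
  · exact Set.indicator_eq_indicator (mem_toSet_congr (I := I.rightChild) hk h) rfl
  · exact Set.indicator_eq_indicator (mem_toSet_congr (I := I.leftChild) hk h) rfl

theorem integrable_haar (I : DyadicInterval) : Integrable (haar I) := by
  unfold haar
  exact (((integrable_indicator_iff measurableSet_Ico).2 (integrableOn_const (by simp))).sub
    ((integrable_indicator_iff measurableSet_Ico).2 (integrableOn_const (by simp)))).const_mul _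

theorem integral_haar (I : DyadicInterval) : ∫ x, haar I x = 0 := by
  have h : ∀ J : DyadicInterval,
      Integrable (J.toSet.indicator fun _ : ℝ => (1 : ℝ)) := fun J =>
    (integrable_indicator_iff J.measurableSet_toSet).2 (integrableOn_const J.volume_ne_top)
  simp_rw [haar_eq_indicator]
  rw [integral_const_mul, integral_sub (h _) (h _),
    integral_indicator_const _ (measurableSet_toSet _),
    integral_indicator_const _ (measurableSet_toSet _)]
  simp [measureReal_def, volume_toSet, len_leftChild, len_rightChild]

theorem integrable_haar_mul_haar (I J : DyadicInterval) :
    Integrable fun x => haar I x * haar J x :=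
  (integrable_haar J).bdd_mul (c := (Real.sqrt I.len)⁻¹)
    (measurable_haar I).aestronglyMeasurable (Eventually.of_forall fun x => by simpa using abs_haar_le I x)

/-- The Haar function of the longer interval is constant on `J`, and `haar J` has mean zero. -/
theorem integral_haar_mul_haar_of_lt {I J : DyadicInterval} (h : I.scale < J.scale) :
    ∫ x, haar I x * haar J x = 0 := by
  have : ∀ x, haar I x * haar J x = haar I J.left * haar J x := by
    intro x
    by_cases hx : x ∈ J.toSet
    · rw [haar_congr h ((mem_toSet_iff.1 hx).trans (mem_toSet_iff.1 J.left_mem).symm)]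
    · rw [haar_of_notMem hx, mul_zero, mul_zero]
  simp_rw [this]
  rw [integral_const_mul, integral_haar, mul_zero]

theorem haar_mul_self (I : DyadicInterval) (x : ℝ) :
    haar I x * haar I x = I.toSet.indicator (fun _ => I.len⁻¹) x := by
  by_cases hx : x ∈ I.toSet
  · rw [Set.indicator_of_mem hx, ← abs_mul_abs_self, abs_haar_of_mem hx, ← mul_inv,
      Real.mul_self_sqrt I.len_pos.le]
  · rw [Set.indicator_of_notMem hx, haar_of_notMem hx, mul_zero]

theorem integral_haar_mul_haar (I J : DyadicInterval) [Decidable (I = J)] :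
    ∫ x, haar I x * haar J x = if I = J then 1 else 0 := by
  split_ifs with h
  · subst h
    simp_rw [haar_mul_self]
    rw [integral_indicator_const _ I.measurableSet_toSet]
    simp [measureReal_def, volume_toSet, I.len_pos.le, I.len_ne_zero]
  rcases lt_trichotomy I.scale J.scale with hs | hs | hs
  · exact integral_haar_mul_haar_of_lt hs
  · have : ∀ x, haar I x * haar J x = 0 := by
      intro x
      by_cases hx : x ∈ I.toSet
      · rw [haar_of_notMem fun hJ => h (eq_of_mem hx hJ hs), mul_zero]
      · rw [haar_of_notMem hx, zero_mul]
    simp [this]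
  · simp_rw [mul_comm (haar I _)]
    exact integral_haar_mul_haar_of_lt hs

/-! ### Haar coefficients, averages and the Bessel inequality -/

section

variable {𝕜 : Type*} [RCLike 𝕜]

theorem integral_norm_sq_sum_haar (F : Finset DyadicInterval) (c : DyadicInterval → 𝕜) :
    ∫ x, ‖∑ I ∈ F, c I * (haar I x : 𝕜)‖ ^ 2 = ∑ I ∈ F, ‖c I‖ ^ 2 := by
  classical
  have key : ∫ x, ((‖∑ I ∈ F, c I * (haar I x : 𝕜)‖ ^ 2 : ℝ) : 𝕜)
      = ((∑ I ∈ F, ‖c I‖ ^ 2 : ℝ) : 𝕜) := by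
    have h1 : ∀ x, ((‖∑ I ∈ F, c I * (haar I x : 𝕜)‖ ^ 2 : ℝ) : 𝕜)
        = ∑ I ∈ F, ∑ J ∈ F, (c I * star (c J)) * ((haar I x * haar J x : ℝ) : 𝕜) := by
      intro x
      push_cast
      rw [← RCLike.mul_conj, map_sum, Finset.sum_mul_sum]
      refine Finset.sum_congr rfl fun I _ => Finset.sum_congr rfl fun J _ => ?_
      rw [map_mul, RCLike.conj_ofReal, RCLike.star_def]
      ring
    simp_rw [h1]
    have hi : ∀ I J : DyadicInterval,
        Integrable fun x => (c I * star (c J)) * ((haar I x * haar J x : ℝ) : 𝕜) := fun I J =>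
      (integrable_haar_mul_haar I J).ofReal.const_mul _
    rw [integral_finsetSum _ fun I _ => integrable_finsetSum _ fun J _ => hi I J,
      show ((∑ I ∈ F, ‖c I‖ ^ 2 : ℝ) : 𝕜) = ∑ I ∈ F, (‖c I‖ : 𝕜) ^ 2 by push_cast; rfl]
    refine Finset.sum_congr rfl fun I hI => ?_
    rw [integral_finsetSum _ fun J _ => hi I J]
    have h2 : ∀ J ∈ F, ∫ x, (c I * star (c J)) * ((haar I x * haar J x : ℝ) : 𝕜)
        = if I = J then ((‖c I‖ : 𝕜)) ^ 2 else 0 := by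
      intro J _
      rw [integral_const_mul, integral_ofReal, integral_haar_mul_haar]
      split_ifs with h
      · subst h
        rw [← RCLike.mul_conj]
        simp
      · simp
    rw [Finset.sum_congr rfl h2, Finset.sum_ite_eq, if_pos hI]
  rw [integral_ofReal] at key
  exact_mod_cast key

/-- The average of `|f|` over `I`. -/
noncomputable def avg (f : ℝ → 𝕜) (I : DyadicInterval) : ℝ := I.len⁻¹ * ∫ x in I.toSet, ‖f x‖

theorem avg_nonneg (f : ℝ → 𝕜) (I : DyadicInterval) : 0 ≤ avg f I :=
  mul_nonneg (inv_nonneg.2 I.len_pos.le) (integral_nonneg fun _ => norm_nonneg _)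

theorem coeff_one (f : ℝ → 𝕜) (I : DyadicInterval) :
    coeff f I 1 = ((I.len : ℝ) : 𝕜)⁻¹ * ∫ x in I.toSet, f x := by
  simp [coeff]

theorem coeff_zero (f : ℝ → 𝕜) (I : DyadicInterval) :
    coeff f I 0 = ∫ x, f x * (haar I x : 𝕜) := by
  simp [coeff]

theorem norm_coeff_one_le (f : ℝ → 𝕜) (I : DyadicInterval) : ‖coeff f I 1‖ ≤ avg f I := by
  rw [coeff_one, norm_mul, norm_inv, RCLike.norm_ofReal, abs_of_pos I.len_pos, avg]
  have := I.len_pos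
  gcongr
  exact norm_integral_le_integral_norm _

theorem norm_coeff_zero_le (f : ℝ → 𝕜) (I : DyadicInterval) :
    ‖coeff f I 0‖ ≤ Real.sqrt I.len * avg f I := by
  rw [coeff_zero]
  refine (norm_integral_le_integral_norm _).trans (le_of_eq ?_)
  have : ∀ x, ‖f x * (haar I x : 𝕜)‖
      = I.toSet.indicator (fun x => (Real.sqrt I.len)⁻¹ * ‖f x‖) x := by
    intro x
    rw [norm_mul, RCLike.norm_ofReal, abs_haar]
    by_cases hx : x ∈ I.toSet <;> simp [hx, mul_comm]
  simp_rw [this]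
  rw [integral_indicator I.measurableSet_toSet, integral_const_mul, avg, ← mul_assoc]
  congr 1
  have := I.len_pos
  field_simp
  rw [Real.sq_sqrt this.le]

theorem coeff_zero_eq_sub {f : ℝ → 𝕜} {I : DyadicInterval} (hf : IntegrableOn f I.toSet) :
    coeff f I 0 = ((Real.sqrt I.len / 2 : ℝ) : 𝕜) *
      (coeff f I.rightChild 1 - coeff f I.leftChild 1) := by
  have hr := (integrable_indicator_iff I.rightChild.measurableSet_toSet).2
    (hf.mono_set I.rightChild_subset)
  have hl := (integrable_indicator_iff I.leftChild.measurableSet_toSet).2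
    (hf.mono_set I.leftChild_subset)
  have : ∀ x, f x * (haar I x : 𝕜) = (((Real.sqrt I.len)⁻¹ : ℝ) : 𝕜) *
      (I.rightChild.toSet.indicator f x - I.leftChild.toSet.indicator f x) := by
    intro x
    rw [haar_eq_indicator]
    by_cases h1 : x ∈ I.rightChild.toSet <;> by_cases h2 : x ∈ I.leftChild.toSet <;>
      simp [h1, h2, mul_comm]
  rw [coeff_zero]
  simp_rw [this]
  rw [integral_const_mul, integral_sub hr hl, integral_indicator (measurableSet_toSet _),
    integral_indicator (measurableSet_toSet _), coeff_one, coeff_one, len_leftChild,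
    len_rightChild, ← mul_sub, ← mul_assoc, ← RCLike.ofReal_inv, ← RCLike.ofReal_mul]
  congr 2
  have h := I.len_pos
  field_simp
  rw [Real.sq_sqrt h.le]

theorem setIntegral_children {E : Type*} [NormedAddCommGroup E] [NormedSpace ℝ E] {f : ℝ → E}
    {I : DyadicInterval} (hf : IntegrableOn f I.toSet) :
    ∫ x in I.toSet, f x = (∫ x in I.leftChild.toSet, f x) + ∫ x in I.rightChild.toSet, f x := by
  conv_lhs => rw [← leftHalf_union_rightHalf, ← toSet_leftChild, ← toSet_rightChild]
  refine setIntegral_union ?_ (measurableSet_toSet _) (hf.mono_set I.leftChild_subset)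
    (hf.mono_set I.rightChild_subset)
  rw [toSet_leftChild, toSet_rightChild]
  exact I.disjoint_halves

theorem coeff_one_eq_add {f : ℝ → 𝕜} {I : DyadicInterval} (hf : IntegrableOn f I.toSet) :
    coeff f I 1 = (2 : 𝕜)⁻¹ * (coeff f I.rightChild 1 + coeff f I.leftChild 1) := by
  rw [coeff_one, coeff_one, coeff_one, setIntegral_children hf, len_leftChild, len_rightChild]
  have : ((I.len : ℝ) : 𝕜) ≠ 0 := by exact_mod_cast I.len_ne_zero
  push_cast
  field_simp
  ring

/-- The parallelogram law for the averages over the two halves. This is energy conservation across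
one generation: passing from `I` to its children releases exactly the squared Haar coefficient, so
the identity telescopes down the tree. -/
theorem norm_sq_coeff_add {f : ℝ → 𝕜} {I : DyadicInterval} (hf : IntegrableOn f I.toSet) :
    ‖coeff f I 0‖ ^ 2 + I.len * ‖coeff f I 1‖ ^ 2
      = I.leftChild.len * ‖coeff f I.leftChild 1‖ ^ 2
        + I.rightChild.len * ‖coeff f I.rightChild 1‖ ^ 2 := by
  have h := I.len_pos
  rw [coeff_zero_eq_sub hf, coeff_one_eq_add hf, norm_mul, norm_mul, RCLike.norm_ofReal,
    norm_inv, RCLike.norm_two, abs_of_nonneg (by positivity), mul_pow, div_pow,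
    Real.sq_sqrt h.le, len_leftChild, len_rightChild]
  have := parallelogram_law_with_norm ℝ (coeff f I.rightChild 1) (coeff f I.leftChild 1)
  linear_combination (I.len / 4) * this

theorem avg_leftChild_le {f : ℝ → 𝕜} {I : DyadicInterval} (hf : IntegrableOn f I.toSet) :
    avg f I.leftChild ≤ 2 * avg f I := by
  have h := I.len_pos
  have : ∫ x in I.leftChild.toSet, ‖f x‖ ≤ ∫ x in I.toSet, ‖f x‖ :=
    setIntegral_mono_set hf.norm (Eventually.of_forall fun _ => norm_nonneg _)
      I.leftChild_subset.eventuallyLE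
  rw [avg, avg, len_leftChild, inv_div, ← mul_assoc, div_eq_mul_inv]
  gcongr

theorem avg_rightChild_le {f : ℝ → 𝕜} {I : DyadicInterval} (hf : IntegrableOn f I.toSet) :
    avg f I.rightChild ≤ 2 * avg f I := by
  have h := I.len_pos
  have : ∫ x in I.rightChild.toSet, ‖f x‖ ≤ ∫ x in I.toSet, ‖f x‖ :=
    setIntegral_mono_set hf.norm (Eventually.of_forall fun _ => norm_nonneg _)
      I.rightChild_subset.eventuallyLE
  rw [avg, avg, len_rightChild, inv_div, ← mul_assoc, div_eq_mul_inv]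
  gcongr

/-- A Bessel inequality for the Haar coefficients at the intervals before the averages of `|f|`
exceed the level `t`. -/
theorem sum_norm_sq_coeff_add_le {f : ℝ → 𝕜} (hf : ∀ I : DyadicInterval, IntegrableOn f I.toSet)
    {t : ℝ} (n : ℕ) (F : Finset DyadicInterval) (J : DyadicInterval)
    (hFJ : ∀ I ∈ F, I.toSet ⊆ J.toSet) (hn : ∀ I ∈ F, I.scale < J.scale + n)
    (hF : ∀ I ∈ F, ∀ L : DyadicInterval, I.toSet ⊆ L.toSet → L.toSet ⊆ J.toSet → avg f L ≤ t)
    (hJ : avg f J ≤ 2 * t) :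
    ∑ I ∈ F, ‖coeff f I 0‖ ^ 2 + J.len * ‖coeff f J 1‖ ^ 2 ≤ 4 * t ^ 2 * J.len := by
  classical
  have hlen := J.len_pos
  -- An empty `F` means that the process has stopped at `J`. Only here is the weaker level `2 * t`
  -- needed: `J` may be the first interval above `t`, and its square produces the factor `4`.
  rcases F.eq_empty_or_nonempty with rfl | ⟨I₀, hI₀⟩
  · have := (norm_coeff_one_le f J).trans hJ
    rw [Finset.sum_empty, zero_add]
    nlinarith [mul_le_mul_of_nonneg_left
      (mul_self_le_mul_self (norm_nonneg (coeff f J 1)) this) hlen.le]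
  induction n generalizing F J I₀ with
  | zero =>
    have h1 := hn I₀ hI₀
    have h2 := scale_le_of_subset (hFJ I₀ hI₀)
    push_cast at h1
    omega
  | succ n ih =>
    -- The inductive hypothesis concerns nonempty families, but the part of `F` below a child may be
    -- empty, so the stopped case is put back.
    have ih' : ∀ (F : Finset DyadicInterval) (J : DyadicInterval),
        (∀ I ∈ F, I.toSet ⊆ J.toSet) → (∀ I ∈ F, I.scale < J.scale + n) →
        (∀ I ∈ F, ∀ L : DyadicInterval, I.toSet ⊆ L.toSet → L.toSet ⊆ J.toSet → avg f L ≤ t) →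
        avg f J ≤ 2 * t →
        ∑ I ∈ F, ‖coeff f I 0‖ ^ 2 + J.len * ‖coeff f J 1‖ ^ 2 ≤ 4 * t ^ 2 * J.len := by
      intro F J h1 h2 h3 h4
      rcases F.eq_empty_or_nonempty with rfl | ⟨I₁, hI₁⟩
      · have := (norm_coeff_one_le f J).trans h4
        have hlen := J.len_pos
        rw [Finset.sum_empty, zero_add]
        nlinarith [mul_le_mul_of_nonneg_left
          (mul_self_le_mul_self (norm_nonneg (coeff f J 1)) this) hlen.le]
      · exact ih F J h1 h2 h3 h4 J.len_pos I₁ hI₁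
    -- As `F` is nonempty, `J` lies above one of its members and the average is at most `t`; the
    -- children then satisfy the bound `2 * t`.
    have hJt : avg f J ≤ t := hF I₀ hI₀ J (hFJ I₀ hI₀) subset_rfl
    have hl := ih' (F.filter fun I => I.toSet ⊆ J.leftChild.toSet) J.leftChild
      (fun I hI => (Finset.mem_filter.1 hI).2)
      (fun I hI => by
        have := hn I (Finset.mem_filter.1 hI).1
        simp only [leftChild]; push_cast at this; omega)
      (fun I hI L h1 h2 => hF I (Finset.mem_filter.1 hI).1 L h1 (h2.trans J.leftChild_subset))
      ((avg_leftChild_le (hf J)).trans (by linarith))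
    have hr := ih' (F.filter fun I => I.toSet ⊆ J.rightChild.toSet) J.rightChild
      (fun I hI => (Finset.mem_filter.1 hI).2)
      (fun I hI => by
        have := hn I (Finset.mem_filter.1 hI).1
        simp only [rightChild]; push_cast at this; omega)
      (fun I hI L h1 h2 => hF I (Finset.mem_filter.1 hI).1 L h1 (h2.trans J.rightChild_subset))
      ((avg_rightChild_le (hf J)).trans (by linarith))
    have hsub : F ⊆ {J} ∪ (F.filter fun I => I.toSet ⊆ J.leftChild.toSet) ∪
        F.filter fun I => I.toSet ⊆ J.rightChild.toSet := by
      intro I hI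
      simp only [Finset.mem_union, Finset.mem_singleton, Finset.mem_filter]
      rcases (scale_le_of_subset (hFJ I hI)).eq_or_lt with hs | hs
      · exact Or.inl (Or.inl (eq_of_mem I.left_mem (hFJ I hI I.left_mem) hs.symm))
      · rcases subset_child (hFJ I hI) hs with h | h
        · exact Or.inl (Or.inr ⟨hI, h⟩)
        · exact Or.inr ⟨hI, h⟩
    have hsum : ∑ I ∈ F, ‖coeff f I 0‖ ^ 2 ≤ ‖coeff f J 0‖ ^ 2
        + ∑ I ∈ F.filter (fun I => I.toSet ⊆ J.leftChild.toSet), ‖coeff f I 0‖ ^ 2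
        + ∑ I ∈ F.filter (fun I => I.toSet ⊆ J.rightChild.toSet), ‖coeff f I 0‖ ^ 2 := by
      refine (Finset.sum_le_sum_of_subset_of_nonneg hsub fun _ _ _ => by positivity).trans ?_
      have hU : ∀ A B : Finset DyadicInterval, ∑ I ∈ A ∪ B, ‖coeff f I 0‖ ^ 2
          ≤ ∑ I ∈ A, ‖coeff f I 0‖ ^ 2 + ∑ I ∈ B, ‖coeff f I 0‖ ^ 2 := by
        intro A B
        rw [← Finset.sum_union_inter]
        exact le_add_of_nonneg_right (Finset.sum_nonneg fun _ _ => by positivity)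
      refine (hU _ _).trans ?_
      gcongr
      refine (hU _ _).trans ?_
      rw [Finset.sum_singleton]
    have := norm_sq_coeff_add (hf J)
    rw [len_leftChild] at hl this
    rw [len_rightChild] at hr this
    linarith

end

/-! ### Partial sums, stopping, and the estimate for the stopped multiplier -/

section

variable {𝕜 : Type*} [RCLike 𝕜]

/-- A family of functions, indexed by the dyadic intervals, in which `a I` lives on `I` and is
constant on the dyadic intervals strictly inside `I`. -/
structure IsHaarFamily (a : DyadicInterval → ℝ → 𝕜) : Prop where
  eq_zero : ∀ I x, x ∉ I.toSet → a I x = 0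
  congr : ∀ (I : DyadicInterval) (k : ℤ) (x y : ℝ), I.scale < k → cube k x = cube k y →
    a I x = a I y

/-- The partial sum over the intervals of `F` that are longer than `2^{-k}`. -/
noncomputable def partialSum (a : DyadicInterval → ℝ → 𝕜) (F : Finset DyadicInterval) (k : ℤ)
    (x : ℝ) : 𝕜 := ∑ I ∈ F with I.scale < k, a I x

variable {a : DyadicInterval → ℝ → 𝕜}

theorem IsHaarFamily.partialSum_congr (ha : IsHaarFamily a) (F : Finset DyadicInterval) {j k : ℤ}
    (hjk : j ≤ k) {x y : ℝ} (h : cube k x = cube k y) :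
    partialSum a F j x = partialSum a F j y :=
  Finset.sum_congr rfl fun I hI =>
    ha.congr I k x y ((Finset.mem_filter.1 hI).2.trans_le hjk) h

theorem exists_scale_lower_bound (F : Finset DyadicInterval) : ∃ k : ℤ, ∀ I ∈ F, k ≤ I.scale := by
  obtain ⟨k, hk⟩ := (F.image scale).bddBelow
  exact ⟨k, fun I hI => hk (by simpa using ⟨I, hI, rfl⟩)⟩

theorem exists_scale_upper_bound (F : Finset DyadicInterval) : ∃ k : ℤ, ∀ I ∈ F, I.scale < k := by
  obtain ⟨k, hk⟩ := (F.image scale).bddAbove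
  exact ⟨k + 1, fun I hI => Int.lt_add_one_of_le (hk (by simpa using ⟨I, hI, rfl⟩))⟩

theorem partialSum_eq_zero {F : Finset DyadicInterval} {k : ℤ} (hk : ∀ I ∈ F, k ≤ I.scale)
    {j : ℤ} (hj : j ≤ k) (x : ℝ) : partialSum a F j x = 0 := by
  rw [partialSum, Finset.filter_false_of_mem, Finset.sum_empty]
  intro I hI
  have := hk I hI
  omega

theorem partialSum_eq_sum {F : Finset DyadicInterval} {k : ℤ} (hk : ∀ I ∈ F, I.scale < k)
    (x : ℝ) : partialSum a F k x = ∑ I ∈ F, a I x := by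
  rw [partialSum, Finset.filter_true_of_mem hk]

theorem exists_least_partialSum {F : Finset DyadicInterval} {t : ℝ} (ht : 0 ≤ t) {x : ℝ}
    (h : ∃ n, t < ‖partialSum a F n x‖) :
    ∃ n, t < ‖partialSum a F n x‖ ∧ ∀ j < n, ‖partialSum a F j x‖ ≤ t := by
  obtain ⟨k, hk⟩ := exists_scale_lower_bound F
  obtain ⟨n, hn, hmin⟩ := Int.exists_least_of_bdd
    (P := fun n => t < ‖partialSum a F n x‖)
    ⟨k, fun z hz => by
      by_contra! hzk
      rw [partialSum_eq_zero hk hzk.le, norm_zero] at hz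
      linarith⟩ h
  refine ⟨n, hn, fun j hj => ?_⟩
  by_contra! hlt
  exact absurd (hmin j hlt) (by omega)

/-- Stopping the partial sums when they exceed the level `t`. -/
theorem IsHaarFamily.exists_stopped (ha : IsHaarFamily a) (F : Finset DyadicInterval) {t : ℝ}
    (ht : 0 ≤ t) : ∃ F' ⊆ F, ∀ x, (∃ n, t < ‖partialSum a F n x‖) → t < ‖∑ I ∈ F', a I x‖ := by
  classical
  -- Keep `I` if no partial sum up to its scale has exceeded `t` on it. These sums are constant on
  -- `I`, so the left end point can represent `I`. If `n` is the first passage time at `x`, the kept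
  -- intervals containing `x` are those in `F` of scale less than `n`.
  refine ⟨F.filter fun I => ∀ n ≤ I.scale, ‖partialSum a F n I.left‖ ≤ t,
    Finset.filter_subset _ _, fun x hx => ?_⟩
  obtain ⟨n, hn, hmin⟩ := exists_least_partialSum ht hx
  convert hn using 2
  rw [partialSum, Finset.sum_filter, Finset.sum_filter]
  refine Finset.sum_congr rfl fun I _ => ?_
  by_cases hxI : x ∈ I.toSet
  · have hc : ∀ j ≤ I.scale, partialSum a F j I.left = partialSum a F j x := fun j hj =>
      ha.partialSum_congr F hj ((mem_toSet_iff.1 I.left_mem).trans (mem_toSet_iff.1 hxI).symm)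
    congr 1
    refine propext ⟨fun h => ?_, fun h j hj => ?_⟩
    · by_contra! hle
      have := h n hle
      rw [hc n hle] at this
      linarith
    · rw [hc j hj]
      exact hmin j (by omega)
  · simp [ha.eq_zero I x hxI]

variable {m : ℕ} {ε : DyadicInterval → 𝕜} {α : Fin m → Fin 2} {f : Fin m → ℝ → 𝕜}

theorem measurable_haarTerm (ε : DyadicInterval → 𝕜) (α : Fin m → Fin 2) (f : Fin m → ℝ → 𝕜)
    (I : DyadicInterval) : Measurable (haarTerm ε α f I) := by
  unfold haarTerm
  exact ((RCLike.measurable_ofReal.comp (measurable_haar I)).pow_const _).const_mul _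

theorem sigma_pos (hα : α ∈ U m) : 0 < sigma α := by
  obtain ⟨j, hj⟩ : ∃ j, α j ≠ 1 := by
    by_contra! h
    exact hα (funext h)
  exact Finset.card_pos.2 ⟨j, by simp; omega⟩

theorem isHaarFamily_haarTerm (hα : α ∈ U m) (ε : DyadicInterval → 𝕜) (f : Fin m → ℝ → 𝕜) :
    IsHaarFamily (haarTerm ε α f) where
  eq_zero I x hx := by simp [haarTerm, haar_of_notMem hx, (sigma_pos hα).ne']
  congr I k x y hk h := by simp [haarTerm, haar_congr hk h]

/-- `|f(I, a)|`, normalized so that it is comparable to the average of `|f|`. -/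
noncomputable def normCoeff (f : ℝ → 𝕜) (I : DyadicInterval) (a : Fin 2) : ℝ :=
  ‖coeff f I a‖ * if a = 0 then (Real.sqrt I.len)⁻¹ else 1

theorem normCoeff_nonneg (f : ℝ → 𝕜) (I : DyadicInterval) (a : Fin 2) : 0 ≤ normCoeff f I a := by
  unfold normCoeff
  positivity

theorem normCoeff_le_avg (f : ℝ → 𝕜) (I : DyadicInterval) (a : Fin 2) :
    normCoeff f I a ≤ avg f I := by
  have h := Real.sqrt_pos.2 I.len_pos
  unfold normCoeff
  split_ifs with ha
  · subst ha
    rw [← div_eq_mul_inv, div_le_iff₀ h, mul_comm]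
    exact norm_coeff_zero_le f I
  · obtain rfl : a = 1 := by omega
    rw [mul_one]
    exact norm_coeff_one_le f I

/-- The `σ(α)` factors `|I|^{-1/2}` coming from the Haar functions are distributed among the
cancellative coefficients, as `normCoeff` is normalized for. -/
theorem norm_haarTerm_of_mem {I : DyadicInterval} {x : ℝ} (hx : x ∈ I.toSet) :
    ‖haarTerm ε α f I x‖ = ‖ε I‖ * ∏ j, normCoeff (f j) I (α j) := by
  rw [haarTerm, norm_mul, norm_mul, norm_prod, norm_pow, RCLike.norm_ofReal, abs_haar_of_mem hx,
    mul_assoc]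
  simp only [normCoeff]
  rw [Finset.prod_mul_distrib, Finset.prod_ite]
  simp [sigma]

theorem norm_haarTerm_le (hα : α ∈ U m) {B : ℝ} (hB : ∀ I, ‖ε I‖ ≤ B) (I : DyadicInterval)
    (x : ℝ) : ‖haarTerm ε α f I x‖ ≤ B * ∏ j, avg (f j) I := by
  have hB0 : 0 ≤ B := (norm_nonneg _).trans (hB I)
  by_cases hx : x ∈ I.toSet
  · rw [norm_haarTerm_of_mem hx]
    gcongr with j
    · exact Finset.prod_nonneg fun j _ => normCoeff_nonneg _ _ _
    · exact hB I
    · exact fun j _ => normCoeff_nonneg _ _ _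
    · exact normCoeff_le_avg _ _ _
  · rw [(isHaarFamily_haarTerm hα ε f).eq_zero I x hx, norm_zero]
    exact mul_nonneg hB0 (Finset.prod_nonneg fun j _ => avg_nonneg _ _)

theorem sum_norm_sq_coeff_le {f : ℝ → 𝕜} (hf : ∀ I : DyadicInterval, IntegrableOn f I.toSet)
    {t : ℝ} {F : Finset DyadicInterval} {J : DyadicInterval}
    (hFJ : ∀ I ∈ F, I.toSet ⊆ J.toSet)
    (hF : ∀ I ∈ F, ∀ L : DyadicInterval, I.toSet ⊆ L.toSet → L.toSet ⊆ J.toSet → avg f L ≤ t)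
    (hJ : avg f J ≤ 2 * t) :
    ∑ I ∈ F, ‖coeff f I 0‖ ^ 2 ≤ 4 * t ^ 2 * J.len := by
  obtain ⟨k, hk⟩ := exists_scale_upper_bound F
  have := sum_norm_sq_coeff_add_le hf (k - J.scale).toNat F J hFJ
    (fun I hI => by have := hk I hI; omega) hF hJ
  have : 0 ≤ J.len * ‖coeff f J 1‖ ^ 2 := mul_nonneg J.len_pos.le (by positivity)
  linarith

theorem memLp_two_haar (I : DyadicInterval) : MemLp (fun x => (haar I x : 𝕜)) 2 := by
  refine MemLp.ofReal ((memLp_two_iff_integrable_sq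
    (measurable_haar I).aestronglyMeasurable).2 ?_)
  simpa [sq] using integrable_haar_mul_haar I I

/-- Chebyshev's inequality in `L²`, with the norm computed by orthogonality. -/
theorem measure_lt_norm_sum_haar_le (F : Finset DyadicInterval) (c : DyadicInterval → 𝕜) {t : ℝ}
    (ht : 0 < t) : volume {x | t < ‖∑ I ∈ F, c I * (haar I x : 𝕜)‖}
      ≤ ENNReal.ofReal ((∑ I ∈ F, ‖c I‖ ^ 2) / t ^ 2) := by
  have hmem : MemLp (fun x => ∑ I ∈ F, c I * (haar I x : 𝕜)) 2 :=
    memLp_finsetSum F fun I _ => (memLp_two_haar I).const_mul (c I)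
  have hint : Integrable fun x => ‖∑ I ∈ F, c I * (haar I x : 𝕜)‖ ^ 2 :=
    hmem.integrable_norm_pow two_ne_zero
  have h1 := mul_meas_ge_le_lintegral₀ (μ := volume)
    (f := fun x => ENNReal.ofReal (‖∑ I ∈ F, c I * (haar I x : 𝕜)‖ ^ 2))
    hint.aestronglyMeasurable.aemeasurable.ennreal_ofReal (ENNReal.ofReal (t ^ 2))
  rw [← ofReal_integral_eq_lintegral_ofReal hint (Eventually.of_forall fun _ => by positivity),
    integral_norm_sq_sum_haar] at h1
  rw [ENNReal.ofReal_div_of_pos (by positivity), ENNReal.le_div_iff_mul_le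
    (Or.inl (by simpa using ht.ne')) (Or.inl (by simp)), mul_comm]
  refine le_trans ?_ h1
  gcongr with x
  exact fun hx => ENNReal.ofReal_le_ofReal (by gcongr)

/-- Chebyshev's inequality in `L¹` and the triangle inequality. No cancellation between terms is
used, which is affordable when `σ(α) ≥ 2`. -/
theorem measure_lt_norm_sum_haarTerm_le (hα : α ∈ U m) (F : Finset DyadicInterval) {t : ℝ}
    (ht : 0 < t) : volume {x | t < ‖∑ I ∈ F, haarTerm ε α f I x‖}
      ≤ ENNReal.ofReal ((∑ I ∈ F, ‖ε I‖ * (∏ j, normCoeff (f j) I (α j)) * I.len) / t) := by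
  have h1 := mul_meas_ge_le_lintegral₀ (μ := volume)
    (f := fun x => ∑ I ∈ F, ‖haarTerm ε α f I x‖ₑ)
    (Finset.measurable_fun_sum _ fun I _ => (measurable_haarTerm ε α f I).enorm).aemeasurable
    (ENNReal.ofReal t)
  rw [lintegral_finsetSum _ fun I _ => (measurable_haarTerm ε α f I).enorm] at h1
  have h2 : ∀ I, ∫⁻ x, ‖haarTerm ε α f I x‖ₑ
      = ENNReal.ofReal (‖ε I‖ * (∏ j, normCoeff (f j) I (α j)) * I.len) := by
    intro I
    have : ∀ x, ‖haarTerm ε α f I x‖ₑ = I.toSet.indicator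
        (fun _ => ENNReal.ofReal (‖ε I‖ * ∏ j, normCoeff (f j) I (α j))) x := by
      intro x
      by_cases hx : x ∈ I.toSet
      · rw [Set.indicator_of_mem hx, ← norm_haarTerm_of_mem hx, ofReal_norm]
      · rw [Set.indicator_of_notMem hx, (isHaarFamily_haarTerm hα ε f).eq_zero I x hx, enorm_zero]
    simp_rw [this]
    rw [lintegral_indicator_const I.measurableSet_toSet, volume_toSet,
      ← ENNReal.ofReal_mul' I.len_pos.le]
  have hnn : ∀ I, 0 ≤ ‖ε I‖ * (∏ j, normCoeff (f j) I (α j)) * I.len := fun I =>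
    mul_nonneg (mul_nonneg (norm_nonneg _)
      (Finset.prod_nonneg fun j _ => normCoeff_nonneg _ _ _)) I.len_pos.le
  simp_rw [h2] at h1
  rw [← ENNReal.ofReal_sum_of_nonneg fun I _ => hnn I] at h1
  rw [ENNReal.ofReal_div_of_pos ht, ENNReal.le_div_iff_mul_le
    (Or.inl (by simpa using ht)) (Or.inl (by simp)), mul_comm]
  refine le_trans ?_ h1
  gcongr with x
  intro hx
  refine le_trans ?_ (enorm_sum_le _ _)
  rw [← ofReal_norm]
  exact ENNReal.ofReal_le_ofReal hx.le

/-- The estimate of the stopped multiplier: by orthogonality if `σ(α) = 1`, and by the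
Cauchy–Schwarz inequality if `σ(α) ≥ 2`. -/
theorem measure_lt_norm_sum_haarTerm_stopped_le (hα : α ∈ U m) {B : ℝ} (hB : ∀ I, ‖ε I‖ ≤ B)
    (hf : ∀ j, ∀ I : DyadicInterval, IntegrableOn (f j) I.toSet) {t : Fin m → ℝ}
    {F : Finset DyadicInterval} {J : DyadicInterval} (hFJ : ∀ I ∈ F, I.toSet ⊆ J.toSet)
    (hF : ∀ I ∈ F, ∀ L : DyadicInterval, I.toSet ⊆ L.toSet → L.toSet ⊆ J.toSet →
      ∀ j, avg (f j) L ≤ t j)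
    (hJ : ∀ j, avg (f j) J ≤ 2 * t j) {s : ℝ} (hs : 0 < s) :
    volume {x | s < ‖∑ I ∈ F, haarTerm ε α f I x‖}
      ≤ ENNReal.ofReal (4 * (B * (∏ j, t j) / s + (B * (∏ j, t j) / s) ^ 2) * J.len) := by
  classical
  have hB0 : 0 ≤ B := (norm_nonneg _).trans (hB J)
  have ht : ∀ j, 0 ≤ t j := fun j => by linarith [hJ j, avg_nonneg (f j) J]
  have hQ : 0 ≤ B * (∏ j, t j) / s :=
    div_nonneg (mul_nonneg hB0 (Finset.prod_nonneg fun j _ => ht j)) hs.le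
  have hlen := J.len_pos
  have hbessel : ∀ j, ∑ I ∈ F, ‖coeff (f j) I 0‖ ^ 2 ≤ 4 * (t j) ^ 2 * J.len := fun j =>
    sum_norm_sq_coeff_le (hf j) hFJ (fun I hI L h1 h2 => hF I hI L h1 h2 j) (hJ j)
  have hw : ∀ I ∈ F, ∀ j, normCoeff (f j) I (α j) ≤ t j := fun I hI j =>
    (normCoeff_le_avg _ _ _).trans (hF I hI I subset_rfl (hFJ I hI) j)
  rcases (Nat.succ_le_of_lt (sigma_pos hα)).eq_or_lt with h1 | h2
  · obtain ⟨i, hi⟩ := Finset.card_eq_one.1 h1.symm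
    have hi0 : ∀ j, α j = 0 ↔ j = i := fun j => by
      have := Finset.ext_iff.1 hi j
      simpa using this
    have hterm : ∀ x, ∑ I ∈ F, haarTerm ε α f I x
        = ∑ I ∈ F, (ε I * ∏ j, coeff (f j) I (α j)) * (haar I x : 𝕜) := fun x => by
      simp [haarTerm, ← h1]
    simp_rw [hterm]
    refine (measure_lt_norm_sum_haar_le F _ hs).trans (ENNReal.ofReal_le_ofReal ?_)
    -- All factors except the `i`-th are averages, bounded by their stopping levels; the Haar
    -- coefficient of `f i` is kept for the Bessel inequality.
    have hc : ∀ I ∈ F, ‖ε I * ∏ j, coeff (f j) I (α j)‖ ^ 2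
        ≤ (B * ∏ j ∈ Finset.univ.erase i, t j) ^ 2 * ‖coeff (f i) I 0‖ ^ 2 := by
      intro I hI
      rw [← mul_pow, norm_mul, norm_prod, ← Finset.mul_prod_erase _ _ (Finset.mem_univ i),
        (hi0 i).2 rfl, mul_comm ‖coeff (f i) I 0‖, ← mul_assoc]
      gcongr with j hj
      · exact hB I
      · have hj0 : α j ≠ 0 := fun h => Finset.ne_of_mem_erase hj ((hi0 j).1 h)
        have := hw I hI j
        rwa [normCoeff, if_neg hj0, mul_one] at this
    have hsum : ∑ I ∈ F, ‖ε I * ∏ j, coeff (f j) I (α j)‖ ^ 2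
        ≤ 4 * (B * ∏ j, t j) ^ 2 * J.len := by
      refine (Finset.sum_le_sum hc).trans ?_
      rw [← Finset.mul_sum]
      refine (mul_le_mul_of_nonneg_left (hbessel i) (by positivity)).trans (le_of_eq ?_)
      rw [← Finset.mul_prod_erase _ t (Finset.mem_univ i)]
      ring
    rw [div_le_iff₀ (by positivity)]
    refine hsum.trans ?_
    have : 4 * (B * ∏ j, t j) ^ 2 * J.len = 4 * (B * (∏ j, t j) / s) ^ 2 * J.len * s ^ 2 := by
      field_simp
    rw [this]
    gcongr
    linarith
  · obtain ⟨i, hi, k, hk, hik⟩ := Finset.one_lt_card.1 h2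
    have hi0 : α i = 0 := (Finset.mem_filter.1 hi).2
    have hk0 : α k = 0 := (Finset.mem_filter.1 hk).2
    refine (measure_lt_norm_sum_haarTerm_le hα F hs).trans (ENNReal.ofReal_le_ofReal ?_)
    have hki : k ∈ Finset.univ.erase i := Finset.mem_erase.2 ⟨hik.symm, Finset.mem_univ _⟩
    have hP : 0 ≤ ∏ j ∈ (Finset.univ.erase i).erase k, t j := Finset.prod_nonneg fun j _ => ht j
    have hc : ∀ I ∈ F, ‖ε I‖ * (∏ j, normCoeff (f j) I (α j)) * I.len
        ≤ B * (∏ j ∈ (Finset.univ.erase i).erase k, t j)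
          * (‖coeff (f i) I 0‖ * ‖coeff (f k) I 0‖) := by
      intro I hI
      have hI0 := I.len_pos
      -- The normalizing factors of the two cancellative places `i` and `k` cancel the length `|I|`,
      -- leaving a product of two Haar coefficients for Cauchy–Schwarz.
      have hsq : (Real.sqrt I.len)⁻¹ * (Real.sqrt I.len)⁻¹ * I.len = 1 := by
        rw [← mul_inv, Real.mul_self_sqrt hI0.le, inv_mul_cancel₀ hI0.ne']
      rw [← Finset.mul_prod_erase _ _ (Finset.mem_univ i), ← Finset.mul_prod_erase _ _ hki]
      have h3 : ∏ j ∈ (Finset.univ.erase i).erase k, normCoeff (f j) I (α j)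
          ≤ ∏ j ∈ (Finset.univ.erase i).erase k, t j :=
        Finset.prod_le_prod (fun j _ => normCoeff_nonneg _ _ _) fun j _ => hw I hI j
      have h4 : ‖ε I‖ * ∏ j ∈ (Finset.univ.erase i).erase k, normCoeff (f j) I (α j)
          ≤ B * ∏ j ∈ (Finset.univ.erase i).erase k, t j := by
        gcongr
        · exact Finset.prod_nonneg fun j _ => normCoeff_nonneg _ _ _
        · exact hB I
      calc _ = (‖ε I‖ * ∏ j ∈ (Finset.univ.erase i).erase k, normCoeff (f j) I (α j))
            * (‖coeff (f i) I 0‖ * ‖coeff (f k) I 0‖)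
            * ((Real.sqrt I.len)⁻¹ * (Real.sqrt I.len)⁻¹ * I.len) := by
              rw [hi0, hk0, normCoeff, normCoeff, if_pos rfl]; ring
        _ ≤ _ := by
              rw [hsq, mul_one]
              gcongr
    have hcs : ∑ I ∈ F, ‖coeff (f i) I 0‖ * ‖coeff (f k) I 0‖ ≤ 4 * (t i * t k) * J.len := by
      refine (Real.sum_mul_le_sqrt_mul_sqrt F _ _).trans ?_
      rw [← Real.sqrt_mul (Finset.sum_nonneg fun _ _ => by positivity)]
      have h0 := ht i
      have h0' := ht k
      refine Real.sqrt_le_iff.2 ⟨by positivity, ?_⟩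
      refine (mul_le_mul (hbessel i) (hbessel k) (Finset.sum_nonneg fun _ _ => by positivity)
        (by positivity)).trans (le_of_eq (by ring))
    have hsum : ∑ I ∈ F, ‖ε I‖ * (∏ j, normCoeff (f j) I (α j)) * I.len
        ≤ 4 * (B * ∏ j, t j) * J.len := by
      refine (Finset.sum_le_sum hc).trans ?_
      rw [← Finset.mul_sum]
      refine (mul_le_mul_of_nonneg_left hcs (mul_nonneg hB0 hP)).trans (le_of_eq ?_)
      rw [← Finset.mul_prod_erase _ t (Finset.mem_univ i), ← Finset.mul_prod_erase _ t hki]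
      ring
    rw [div_le_iff₀ hs]
    refine hsum.trans ?_
    have : 4 * (B * ∏ j, t j) * J.len = 4 * (B * (∏ j, t j) / s) * J.len * s := by
      field_simp
    rw [this]
    gcongr
    have : 0 ≤ (B * (∏ j, t j) / s) ^ 2 := by positivity
    linarith

end

/-! ### The good-λ inequality -/

section

variable {𝕜 : Type*} [RCLike 𝕜]

theorem setLIntegral_enorm_eq {f : ℝ → 𝕜} {I : DyadicInterval} (hf : IntegrableOn f I.toSet) :
    ∫⁻ x in I.toSet, ‖f x‖ₑ = ENNReal.ofReal (avg f I * I.len) := by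
  rw [← ofReal_integral_norm_eq_lintegral_enorm hf, avg, mul_comm, ← mul_assoc,
    mul_inv_cancel₀ I.len_ne_zero, one_mul]

theorem avg_eq_zero_of_subset {f : ℝ → 𝕜} {I J : DyadicInterval} (hf : IntegrableOn f J.toSet)
    (hIJ : I.toSet ⊆ J.toSet) (h : avg f J = 0) : avg f I = 0 := by
  have h1 : ENNReal.ofReal (avg f I * I.len) ≤ ENNReal.ofReal (avg f J * J.len) := by
    rw [← setLIntegral_enorm_eq hf, ← setLIntegral_enorm_eq (hf.mono_set hIJ)]
    exact lintegral_mono_set hIJ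
  rw [h, zero_mul, ENNReal.ofReal_zero, nonpos_iff_eq_zero, ENNReal.ofReal_eq_zero] at h1
  exact le_antisymm (nonpos_of_mul_nonpos_left h1 I.len_pos) (avg_nonneg f I)

/-- The weak type estimate of the local dyadic maximal function. -/
theorem volume_biUnion_lt_avg_le {f : ℝ → 𝕜} {J : DyadicInterval} (hf : IntegrableOn f J.toSet)
    {K : ℝ} (hK : 0 < K) :
    volume (⋃ I ∈ {I : DyadicInterval | I.toSet ⊆ J.toSet ∧ K * avg f J < avg f I}, I.toSet)
      ≤ ENNReal.ofReal (K⁻¹ * J.len) := by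
  -- The main argument divides by `avg f J`. If it vanishes, so do all averages inside `J` and the
  -- set is empty.
  rcases (avg_nonneg f J).eq_or_lt with h0 | h0
  · have : {I : DyadicInterval | I.toSet ⊆ J.toSet ∧ K * avg f J < avg f I} = ∅ := by
      ext I
      simp only [Set.mem_ofPred_eq, Set.mem_empty_iff_false, iff_false, not_and, not_lt]
      intro hI
      rw [avg_eq_zero_of_subset hf hI h0.symm, ← h0, mul_zero]
    simp [this]
  have h := measure_biUnion_le
    (Q := {I : DyadicInterval | I.toSet ⊆ J.toSet ∧ K * avg f J < avg f I})
    (μ := ENNReal.ofReal (K * avg f J) • volume) (ν := volume.withDensity fun x => ‖f x‖ₑ)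
    (fun I hI => by
      rw [Measure.smul_apply, smul_eq_mul, withDensity_apply _ I.measurableSet_toSet,
        setLIntegral_enorm_eq (hf.mono_set hI.1), volume_toSet,
        ← ENNReal.ofReal_mul (by positivity)]
      have := I.len_pos
      have := hI.2
      gcongr)
  have h2 : (volume.withDensity fun x => ‖f x‖ₑ)
      (⋃ I ∈ {I : DyadicInterval | I.toSet ⊆ J.toSet ∧ K * avg f J < avg f I}, I.toSet)
      ≤ ENNReal.ofReal (avg f J * J.len) := by
    rw [← setLIntegral_enorm_eq hf, ← withDensity_apply _ J.measurableSet_toSet]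
    exact measure_mono (Set.iUnion₂_subset fun I hI => hI.1)
  have h3 := h.trans h2
  rw [Measure.smul_apply, smul_eq_mul, mul_comm, ← ENNReal.le_div_iff_mul_le
    (Or.inl (by simp; positivity)) (Or.inl (by simp)), ← ENNReal.ofReal_div_of_pos (by positivity)]
    at h3
  refine h3.trans (ENNReal.ofReal_le_ofReal (le_of_eq ?_))
  field_simp

/-- The dyadic maximal function. -/
noncomputable def maximal (f : ℝ → 𝕜) (x : ℝ) : ℝ≥0∞ := ⨆ k : ℤ, ENNReal.ofReal (avg f (cube k x))

theorem avg_le_maximal (f : ℝ → 𝕜) {I : DyadicInterval} {x : ℝ} (hx : x ∈ I.toSet) :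
    ENNReal.ofReal (avg f I) ≤ maximal f x := by
  rw [← mem_toSet_iff.1 hx]
  exact le_iSup (fun k : ℤ => ENNReal.ofReal (avg f (cube k x))) _

/-- The maximal partial sum. -/
noncomputable def maximalSum (a : DyadicInterval → ℝ → 𝕜) (F : Finset DyadicInterval) (x : ℝ) :
    ℝ≥0∞ := ⨆ k : ℤ, ‖partialSum a F k x‖ₑ

variable {m : ℕ} {ε : DyadicInterval → 𝕜} {α : Fin m → Fin 2} {f : Fin m → ℝ → 𝕜}

/-- Remove the set `E j` where some average of `|f j|` inside `J` exceeds `K` times the average over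
`J`; the sets removed have measure at most `m K⁻¹ |J|`. At any other `x`, every interval between `x`
and `J` satisfies `P`, so the increment past `J` is a partial sum over the intervals with `P`.
Stopping it at level `s` gives a finite sum to which the local estimate applies with levels `K * avg
(f j) J`. -/
theorem volume_lt_partialSum_sub_le (hα : α ∈ U m) {B : ℝ} (hB : ∀ I, ‖ε I‖ ≤ B)
    (hf : ∀ j, ∀ I : DyadicInterval, IntegrableOn (f j) I.toSet)
    (F : Finset DyadicInterval) (J : DyadicInterval) {K δ s : ℝ} (hK : 1 ≤ K) (hs : 0 < s)
    (hδ : B * K ^ m * ∏ j, avg (f j) J ≤ δ * s) :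
    volume {x ∈ J.toSet | ∃ n, J.scale ≤ n ∧ s < ‖partialSum (haarTerm ε α f) F n x
        - partialSum (haarTerm ε α f) F J.scale x‖}
      ≤ ENNReal.ofReal ((m * K⁻¹ + 4 * (δ + δ ^ 2)) * J.len) := by
  classical
  have ha := isHaarFamily_haarTerm hα ε f
  have hB0 : 0 ≤ B := (norm_nonneg _).trans (hB J)
  have hK0 : 0 < K := by linarith
  have hlen := J.len_pos
  let P : DyadicInterval → Prop := fun I => I.toSet ⊆ J.toSet ∧
    ∀ L : DyadicInterval, I.toSet ⊆ L.toSet → L.toSet ⊆ J.toSet → ∀ j, avg (f j) L ≤ K * avg (f j) J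
  obtain ⟨F', hF', hstopped⟩ := ha.exists_stopped (F.filter P) hs.le
  let E : Fin m → Set ℝ := fun j =>
    ⋃ I ∈ {I : DyadicInterval | I.toSet ⊆ J.toSet ∧ K * avg (f j) J < avg (f j) I}, I.toSet
  have hsub : {x ∈ J.toSet | ∃ n, J.scale ≤ n ∧ s < ‖partialSum (haarTerm ε α f) F n x
        - partialSum (haarTerm ε α f) F J.scale x‖}
      ⊆ (⋃ j, E j) ∪ {x | s < ‖∑ I ∈ F', haarTerm ε α f I x‖} := by
    rintro x ⟨hxJ, n, hn, hx⟩
    by_cases hxE : x ∈ ⋃ j, E j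
    · exact Or.inl hxE
    refine Or.inr (hstopped x ⟨n, ?_⟩)
    have hgood : ∀ L : DyadicInterval, x ∈ L.toSet → L.toSet ⊆ J.toSet →
        ∀ j, avg (f j) L ≤ K * avg (f j) J := by
      intro L hxL hL j
      by_contra! hlt
      exact hxE (Set.mem_iUnion.2 ⟨j, Set.mem_biUnion (show L ∈ {I : DyadicInterval | _} from
        ⟨hL, hlt⟩) hxL⟩)
    convert hx using 2
    rw [partialSum, partialSum, partialSum, Finset.sum_filter, Finset.sum_filter,
      Finset.sum_filter, Finset.sum_filter, ← Finset.sum_sub_distrib]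
    refine Finset.sum_congr rfl fun I _ => ?_
    by_cases hxI : x ∈ I.toSet
    · by_cases hIJ : I.scale < J.scale
      · have hP : ¬ P I := fun h => absurd (scale_le_of_subset h.1) (by omega)
        rw [if_neg hP, if_pos hIJ, if_pos (by omega), sub_self]
      · have hP : P I := by
          have hIJ' := subset_of_mem hxI hxJ (not_lt.1 hIJ)
          exact ⟨hIJ', fun L h1 h2 => hgood L (h1 hxI) h2⟩
        rw [if_pos hP, if_neg hIJ, sub_zero]
    · simp [ha.eq_zero I x hxI]
  have hE : volume (⋃ j, E j) ≤ ENNReal.ofReal (m * K⁻¹ * J.len) := by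
    refine (measure_iUnion_fintype_le _ _).trans ?_
    refine (Finset.sum_le_sum fun j _ => volume_biUnion_lt_avg_le (hf j J) hK0).trans ?_
    rw [Finset.sum_const, Finset.card_univ, Fintype.card_fin, ← ENNReal.ofReal_nsmul,
      nsmul_eq_mul, mul_assoc]
  have hprod : B * (∏ j, K * avg (f j) J) / s ≤ δ := by
    rw [div_le_iff₀ hs, Finset.prod_mul_distrib, Finset.prod_const, Finset.card_univ,
      Fintype.card_fin, ← mul_assoc]
    exact hδ
  have hprod0 : 0 ≤ B * (∏ j, K * avg (f j) J) / s :=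
    div_nonneg (mul_nonneg hB0 (Finset.prod_nonneg fun j _ =>
      mul_nonneg hK0.le (avg_nonneg _ _))) hs.le
  have hT := measure_lt_norm_sum_haarTerm_stopped_le hα hB hf (t := fun j => K * avg (f j) J)
    (F := F') (J := J) (fun I hI => (Finset.mem_filter.1 (hF' hI)).2.1)
    (fun I hI => (Finset.mem_filter.1 (hF' hI)).2.2)
    (fun j => by nlinarith [avg_nonneg (f j) J]) hs
  calc _ ≤ _ := measure_mono hsub
    _ ≤ _ := measure_union_le _ _
    _ ≤ ENNReal.ofReal (m * K⁻¹ * J.len) + ENNReal.ofReal (4 * (δ + δ ^ 2) * J.len) := by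
        refine add_le_add hE (hT.trans (ENNReal.ofReal_le_ofReal ?_))
        gcongr
    _ = _ := by
        have hδ0 := hprod0.trans hprod
        rw [← ENNReal.ofReal_add (by positivity) (by positivity), add_mul]

/-- The good-`λ` inequality between the maximal partial sums of the multiplier and the product of
the maximal functions. -/
theorem exists_good_lambda (hα : α ∈ U m) {B : ℝ} (hB : ∀ I, ‖ε I‖ ≤ B) {η : ℝ} (hη : 0 < η) :
    ∃ γ : ℝ, 0 < γ ∧ ∀ f : Fin m → ℝ → 𝕜,
      (∀ j, ∀ I : DyadicInterval, IntegrableOn (f j) I.toSet) →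
      ∀ (F : Finset DyadicInterval) (s : ℝ), 0 < s →
        volume {x | ENNReal.ofReal (3 * s) < maximalSum (haarTerm ε α f) F x ∧
            ∏ j, maximal (f j) x ≤ ENNReal.ofReal (γ * s)}
          ≤ ENNReal.ofReal η * volume {x | ENNReal.ofReal s < maximalSum (haarTerm ε α f) F x} := by
  classical
  have hB0 : 0 ≤ B := (norm_nonneg _).trans (hB ⟨0, 0⟩)
  -- The constants are chosen so that both losses of the local estimate are at most half of `η`: `m
  -- K⁻¹ ≤ η / 2`, and `4 (δ + δ²) ≤ 8 δ ≤ η / 2` since `δ ≤ 1`. Then `γ` makes `B K^m γ ≤ δ`.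
  set K : ℝ := 1 + 2 * m / η with hKdef
  have hK : 1 ≤ K := le_add_of_nonneg_right (by positivity)
  set δ : ℝ := min 1 η / 16 with hδdef
  have hδ : 0 < δ := by positivity
  have hδ1 : δ ≤ 1 := by rw [hδdef]; linarith [min_le_left 1 η]
  have hδη : 16 * δ ≤ η := by rw [hδdef]; linarith [min_le_right 1 η]
  have hKm : 1 ≤ K ^ m := one_le_pow₀ hK
  have hmK : m * K⁻¹ ≤ η / 2 := by
    rw [← div_eq_mul_inv, div_le_iff₀ (by linarith), hKdef]
    have : η / 2 * (1 + 2 * m / η) = η / 2 + m := by field_simp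
    rw [this]
    linarith
  set γ : ℝ := δ / (B * K ^ m + 1) with hγdef
  have hden : 0 < B * K ^ m + 1 := by positivity
  have hγ : 0 < γ := by positivity
  have hBγ : B * K ^ m * γ ≤ δ := by
    rw [hγdef, mul_div_assoc', div_le_iff₀ hden]
    nlinarith
  have hBγ1 : B * γ ≤ 1 := by
    refine le_trans ?_ (hBγ.trans hδ1)
    gcongr
    exact le_mul_of_one_le_right hB0 hKm
  refine ⟨γ, hγ, fun f hf F s hs => ?_⟩
  have ha := isHaarFamily_haarTerm hα ε f
  obtain ⟨k₀, hk₀⟩ := exists_scale_lower_bound F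
  set S := partialSum (haarTerm ε α f) F with hS
  have hlt : ∀ (t : ℝ), 0 ≤ t → ∀ x, ENNReal.ofReal t < maximalSum (haarTerm ε α f) F x ↔
      ∃ n, t < ‖S n x‖ := by
    intro t ht x
    rw [maximalSum, lt_iSup_iff]
    refine exists_congr fun n => ?_
    rw [← ofReal_norm, ENNReal.ofReal_lt_ofReal_iff_of_nonneg ht]
  -- The intervals on which the sum over strictly longer intervals exceeds `s`. Their union is the
  -- level set of the maximal sum, and since `F` is finite their scales are bounded below, so they
  -- lie in maximal ones.
  let Q : Set DyadicInterval := {J | s < ‖S J.scale J.left‖}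
  have hQmem : ∀ n x, s < ‖S n x‖ → cube n x ∈ Q := by
    intro n x hx
    change s < ‖S n (cube n x).left‖
    rwa [hS, ha.partialSum_congr F le_rfl
      (show cube n (cube n x).left = cube n x from mem_toSet_iff.1 (left_mem _))]
  have hQ : ∀ J ∈ Q, k₀ ≤ J.scale := by
    intro J hJ
    by_contra! h
    have hJ' : s < ‖S J.scale J.left‖ := hJ
    rw [hS, partialSum_eq_zero hk₀ h.le, norm_zero] at hJ'
    linarith
  have hcongr : ∀ (J : DyadicInterval) (j : ℤ), j ≤ J.scale → ∀ x ∈ J.toSet, ∀ y ∈ J.toSet,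
      S j x = S j y := fun J j hj x hx y hy =>
    ha.partialSum_congr F hj ((mem_toSet_iff.1 hx).trans (mem_toSet_iff.1 hy).symm)
  have hUQ : {x | ENNReal.ofReal s < maximalSum (haarTerm ε α f) F x} = ⋃ J ∈ Q, J.toSet := by
    ext x
    simp only [Set.mem_ofPred_eq, Set.mem_iUnion, exists_prop]
    rw [hlt s hs.le]
    constructor
    · rintro ⟨n, hn⟩
      exact ⟨cube n x, hQmem n x hn, mem_cube n x⟩
    · rintro ⟨J, hJ, hx⟩
      refine ⟨J.scale, ?_⟩
      rw [hcongr J J.scale le_rfl x hx J.left J.left_mem]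
      exact hJ
  set A : Set ℝ := {x | ENNReal.ofReal (3 * s) < maximalSum (haarTerm ε α f) F x ∧
            ∏ j, maximal (f j) x ≤ ENNReal.ofReal (γ * s)} with hA
  have hAQ : A ⊆ ⋃ J ∈ Q, J.toSet := by
    rw [← hUQ]
    intro x hx
    exact (ENNReal.ofReal_le_ofReal (by linarith)).trans_lt hx.1
  have havg : ∀ x ∈ A, ∀ I : DyadicInterval, x ∈ I.toSet → ∏ j, avg (f j) I ≤ γ * s := by
    intro x hx I hxI
    rw [← ENNReal.ofReal_le_ofReal_iff (by positivity),
      ENNReal.ofReal_prod_of_nonneg fun j _ => avg_nonneg _ _]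
    exact (Finset.prod_le_prod' fun j _ => avg_le_maximal (f j) hxI).trans hx.2
  have hloc : ∀ J ∈ maximals Q, volume.restrict A J.toSet
      ≤ (ENNReal.ofReal η • volume : Measure ℝ) J.toSet := by
    intro J hJ
    rw [Measure.restrict_apply J.measurableSet_toSet, Measure.smul_apply, smul_eq_mul,
      volume_toSet, ← ENNReal.ofReal_mul hη.le]
    rcases (J.toSet ∩ A).eq_empty_or_nonempty with h0 | ⟨x₀, hx₀J, hx₀⟩
    · simp [h0]
    -- By maximality of `J`, no sum stopping before the scale of `J` has exceeded `s` on it.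
    have hbefore : ∀ j < J.scale, ∀ x ∈ J.toSet, ‖S j x‖ ≤ s := by
      intro j hj x hx
      by_contra! h
      have h1 := hJ.2 _ (hQmem j x h) (subset_of_mem hx (mem_cube j x) hj.le)
      rw [← h1] at hj
      simp at hj
    -- The two partial sums differ by at most one term, that of the parent of `J`. At `x₀ ∈ A` the
    -- product of averages over the parent is at most `γ s`, and `B γ ≤ 1`. So the sum is at most `2
    -- s` on `J`, and exceeding `3 s` requires a further increment greater than `s`.
    have hjump : ‖S J.scale x₀ - S (J.scale - 1) x₀‖ ≤ s := by
      have h1 : S J.scale x₀ - S (J.scale - 1) x₀ = ∑ I ∈ F,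
          if I = cube (J.scale - 1) x₀ then haarTerm ε α f I x₀ else 0 := by
        rw [hS, partialSum, partialSum, Finset.sum_filter, Finset.sum_filter,
          ← Finset.sum_sub_distrib]
        refine Finset.sum_congr rfl fun I _ => ?_
        by_cases hxI : x₀ ∈ I.toSet
        · have hI := mem_toSet_iff.1 hxI
          by_cases h2 : I.scale = J.scale - 1
          · rw [if_pos (by omega), if_neg (by omega), if_pos (by rw [← h2, hI]), sub_zero]
          · rw [if_neg (c := I = _) (fun h => h2 (by rw [h]; rfl))]
            by_cases h3 : I.scale < J.scale
            · rw [if_pos h3, if_pos (by omega), sub_self]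
            · rw [if_neg h3, if_neg (by omega), sub_self]
        · simp [ha.eq_zero I x₀ hxI]
      rw [h1, Finset.sum_ite_eq']
      split_ifs
      · refine (norm_haarTerm_le hα hB _ _).trans ?_
        have h2 := havg x₀ hx₀ _ (mem_cube (J.scale - 1) x₀)
        calc _ ≤ B * (γ * s) := by gcongr
          _ = (B * γ) * s := by ring
          _ ≤ 1 * s := by gcongr
          _ = s := one_mul s
      · rw [norm_zero]; exact hs.le
    have hat : ∀ x ∈ J.toSet, ‖S J.scale x‖ ≤ 2 * s := by
      intro x hx
      rw [hcongr J J.scale le_rfl x hx x₀ hx₀J]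
      have h1 := hbefore (J.scale - 1) (by omega) x₀ hx₀J
      have h2 := norm_sub_norm_le (S J.scale x₀) (S (J.scale - 1) x₀)
      linarith
    have hsub : J.toSet ∩ A ⊆ {x ∈ J.toSet | ∃ n, J.scale ≤ n ∧ s < ‖S n x - S J.scale x‖} := by
      rintro x ⟨hxJ, hxA⟩
      obtain ⟨n, hn⟩ := (hlt (3 * s) (by positivity) x).1 hxA.1
      refine ⟨hxJ, n, ?_, ?_⟩
      · by_contra! h
        have := hbefore n h x hxJ
        linarith
      · have h1 := hat x hxJ
        have h2 := norm_sub_norm_le (S n x) (S J.scale x)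
        linarith
    refine (measure_mono hsub).trans
      ((volume_lt_partialSum_sub_le hα hB hf F J hK hs (δ := δ) ?_).trans
        (ENNReal.ofReal_le_ofReal ?_))
    · calc B * K ^ m * ∏ j, avg (f j) J ≤ B * K ^ m * (γ * s) := by
            gcongr
            exact havg x₀ hx₀ J hx₀J
        _ = B * K ^ m * γ * s := by ring
        _ ≤ δ * s := by gcongr
    · have := J.len_pos
      gcongr
      nlinarith
  have h := measure_biUnion_le_of_maximals hQ hloc
  rw [Measure.restrict_apply (MeasurableSet.biUnion (Set.to_countable _)
    fun I _ => I.measurableSet_toSet), Set.inter_eq_self_of_subset_right hAQ,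
    Measure.smul_apply, smul_eq_mul, ← hUQ] at h
  exact h

end

/-! ### Distribution functions -/

/-- The layer-cake formula for extended-valued functions. A second measure `μ` is allowed because
the maximal theorem uses it for `|f| dx`. -/
theorem lintegral_rpow_eq_lintegral_meas_lt {g : ℝ → ℝ≥0∞} (hg : AEMeasurable g)
    (hfin : ∀ᵐ x, g x < ∞) {r : ℝ} (hr : 0 < r) {μ : Measure ℝ} (hμ : μ ≪ volume) :
    ∫⁻ x, g x ^ r ∂μ = ENNReal.ofReal r *
      ∫⁻ t in Set.Ioi (0 : ℝ), μ {x | ENNReal.ofReal t < g x} * ENNReal.ofReal (t ^ (r - 1)) := by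
  have hfin' : ∀ᵐ x ∂μ, g x < ∞ := hμ.ae_le hfin
  have h1 : ∫⁻ x, g x ^ r ∂μ = ∫⁻ x, ENNReal.ofReal ((g x).toReal ^ r) ∂μ := by
    refine lintegral_congr_ae (hfin'.mono fun x hx => ?_)
    simp only
    rw [← ENNReal.ofReal_rpow_of_nonneg ENNReal.toReal_nonneg hr.le, ENNReal.ofReal_toReal hx.ne]
  rw [h1, lintegral_rpow_eq_lintegral_meas_lt_mul μ (Eventually.of_forall fun _ =>
    ENNReal.toReal_nonneg) (hg.mono_ac hμ).ennreal_toReal hr]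
  congr 1
  refine setLIntegral_congr_fun measurableSet_Ioi fun t ht => ?_
  congr 1
  refine measure_congr (hfin'.mono fun x hx => ?_)
  refine propext ?_
  change t < (g x).toReal ↔ ENNReal.ofReal t < g x
  rw [ENNReal.ofReal_lt_iff_lt_toReal (le_of_lt ht) hx.ne]

theorem lintegral_rpow_le_of_meas_lt_le {g h₁ h₂ : ℝ → ℝ≥0∞} (hg : AEMeasurable g)
    (hh₁ : AEMeasurable h₁) (hh₂ : AEMeasurable h₂) (hgf : ∀ᵐ x, g x < ∞)
    (hf₁ : ∀ᵐ x, h₁ x < ∞) (hf₂ : ∀ᵐ x, h₂ x < ∞) {r : ℝ} (hr : 0 < r) {η : ℝ≥0∞}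
    (h : ∀ t : ℝ, 0 < t → volume {x | ENNReal.ofReal t < g x}
      ≤ η * volume {x | ENNReal.ofReal t < h₁ x} + volume {x | ENNReal.ofReal t < h₂ x}) :
    ∫⁻ x, g x ^ r ≤ η * (∫⁻ x, h₁ x ^ r) + ∫⁻ x, h₂ x ^ r := by
  have hm : ∀ u : ℝ → ℝ≥0∞, Measurable fun t : ℝ => volume {x | ENNReal.ofReal t < u x} := by
    intro u
    refine Antitone.measurable fun a b hab => measure_mono fun x hx => ?_
    exact lt_of_le_of_lt (ENNReal.ofReal_le_ofReal hab) hx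
  have hw : Measurable fun t : ℝ => ENNReal.ofReal (t ^ (r - 1)) := by fun_prop
  have hmw : Measurable fun t : ℝ =>
    volume {x | ENNReal.ofReal t < h₁ x} * ENNReal.ofReal (t ^ (r - 1)) := (hm h₁).mul hw
  rw [lintegral_rpow_eq_lintegral_meas_lt hg hgf hr Measure.AbsolutelyContinuous.rfl,
    lintegral_rpow_eq_lintegral_meas_lt hh₁ hf₁ hr Measure.AbsolutelyContinuous.rfl,
    lintegral_rpow_eq_lintegral_meas_lt hh₂ hf₂ hr Measure.AbsolutelyContinuous.rfl,
    mul_left_comm, ← mul_add, ← lintegral_const_mul _ hmw, ← lintegral_add_left (hmw.const_mul _)]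
  gcongr ENNReal.ofReal r * ?_
  refine setLIntegral_mono' measurableSet_Ioi fun t ht => ?_
  rw [← mul_assoc, ← add_mul]
  gcongr
  exact h t ht

/-- The weak bound at level `n` gives `n ^ r * volume {g = ∞} ≤ N` for all `n`. -/
theorem ae_lt_top_of_weak {g : ℝ → ℝ≥0∞} {r : ℝ} (hr : 0 < r) {N : ℝ≥0∞} (hN : N ≠ ∞)
    (h : ∀ s : ℝ, 0 < s → ENNReal.ofReal s ^ r * volume {x | ENNReal.ofReal s < g x} ≤ N) :
    ∀ᵐ x, g x < ∞ := by
  have h0 : volume {x | g x = ∞} = 0 := by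
    by_contra hne
    have h1 : ∀ n : ℕ, ((n : ℝ≥0∞)) ^ r * volume {x | g x = ∞} ≤ N := by
      intro n
      rcases n.eq_zero_or_pos with rfl | hn
      · simp [hr]
      refine le_trans ?_ (h n (by exact_mod_cast hn))
      rw [ENNReal.ofReal_natCast]
      gcongr
      intro hx
      simp only [hx]
      exact ENNReal.natCast_lt_top n
    have hN' : N / volume {x | g x = ∞} ≠ ∞ := ENNReal.div_ne_top hN hne
    have hN2 : (N / volume {x | g x = ∞}) ^ (1 / r) ≠ ∞ :=
      ENNReal.rpow_ne_top_of_nonneg (by positivity) hN'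
    obtain ⟨n, hn⟩ := ENNReal.exists_nat_gt hN2
    have h2 := h1 n
    by_cases htop : volume {x | g x = ∞} = ∞
    · have hn0 : (n : ℝ≥0∞) ^ r ≠ 0 := by
        have : (n : ℝ≥0∞) ≠ 0 := (lt_of_le_of_lt zero_le hn).ne'
        simp [ENNReal.rpow_eq_zero_iff, this]
      rw [htop, ENNReal.mul_top hn0, top_le_iff] at h2
      exact hN h2
    rw [← ENNReal.le_div_iff_mul_le (Or.inl hne) (Or.inl htop)] at h2
    have h3 := ENNReal.rpow_le_rpow h2 (z := 1 / r) (by positivity)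
    rw [← ENNReal.rpow_mul, mul_one_div_cancel hr.ne', ENNReal.rpow_one] at h3
    exact absurd hn (not_lt.2 h3)
  rw [ae_iff]
  simpa using h0

/-! ### Weak and strong control of the maximal partial sums -/

section

variable {𝕜 : Type*} [RCLike 𝕜]

variable {m : ℕ} {ε : DyadicInterval → 𝕜} {α : Fin m → Fin 2} {f : Fin m → ℝ → 𝕜}

theorem measurable_partialSum (F : Finset DyadicInterval) (k : ℤ) :
    Measurable (partialSum (haarTerm ε α f) F k) :=
  Finset.measurable_fun_sum _ fun I _ => measurable_haarTerm ε α f I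

theorem measurable_maximalSum (F : Finset DyadicInterval) :
    Measurable (maximalSum (haarTerm ε α f) F) :=
  Measurable.iSup fun k => (measurable_partialSum F k).enorm

theorem enorm_sum_le_maximalSum (a : DyadicInterval → ℝ → 𝕜) (F : Finset DyadicInterval) (x : ℝ) :
    ‖∑ I ∈ F, a I x‖ₑ ≤ maximalSum a F x := by
  obtain ⟨k, hk⟩ := exists_scale_upper_bound F
  rw [← partialSum_eq_sum hk]
  exact le_iSup (fun k : ℤ => ‖partialSum a F k x‖ₑ) k

/-- Qualitative only: `C` depends on `F` and `f`. It provides the a priori finiteness without which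
the good-λ term could not be absorbed. -/
theorem exists_maximalSum_le (hα : α ∈ U m) (ε : DyadicInterval → 𝕜) (f : Fin m → ℝ → 𝕜)
    (F : Finset DyadicInterval) : ∃ C : ℝ≥0, ∀ x, maximalSum (haarTerm ε α f) F x
      ≤ (⋃ I ∈ F, I.toSet).indicator (fun _ => (C : ℝ≥0∞)) x := by
  have ha := isHaarFamily_haarTerm hα ε f
  refine ⟨∑ I ∈ F, (‖ε I‖ * ∏ j, avg (f j) I).toNNReal, fun x => iSup_le fun k => ?_⟩
  by_cases hx : x ∈ ⋃ I ∈ F, I.toSet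
  · rw [Set.indicator_of_mem hx, ENNReal.ofNNReal_finsetSum]
    refine (enorm_sum_le _ _).trans ((Finset.sum_le_sum_of_subset (Finset.filter_subset _ _)).trans
      (Finset.sum_le_sum fun I _ => ?_))
    rw [← ofReal_norm]
    refine ENNReal.ofReal_le_ofReal ?_
    by_cases hxI : x ∈ I.toSet
    · rw [norm_haarTerm_of_mem hxI]
      gcongr with j
      · exact fun j _ => normCoeff_nonneg _ _ _
      · exact normCoeff_le_avg _ _ _
    · rw [ha.eq_zero I x hxI, norm_zero]
      exact mul_nonneg (norm_nonneg _) (Finset.prod_nonneg fun j _ => avg_nonneg _ _)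
  · rw [Set.indicator_of_notMem hx, partialSum, Finset.sum_eq_zero, enorm_zero]
    intro I hI
    refine ha.eq_zero I x fun hxI => hx ?_
    exact Set.mem_biUnion (Finset.mem_filter.1 hI).1 hxI

theorem measurable_maximal (f : ℝ → 𝕜) : Measurable (maximal f) := by
  refine Measurable.iSup fun k => ENNReal.measurable_ofReal.comp ?_
  have : (fun x => avg f (cube k x)) = (fun n : ℤ => avg f ⟨n, k⟩) ∘ fun x : ℝ => ⌊x * 2 ^ k⌋ := rfl
  rw [this]
  exact (measurable_of_countable _).comp (Int.measurable_floor.comp (measurable_id.mul_const _))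

theorem volume_biUnion_toSet_ne_top (F : Finset DyadicInterval) :
    volume (⋃ I ∈ F, I.toSet) ≠ ∞ :=
  ((measure_biUnion_finset_le F _).trans_lt
    (ENNReal.sum_lt_top.2 fun I _ => I.volume_ne_top.lt_top)).ne

theorem exists_meas_lt_maximalSum_le (hα : α ∈ U m) {B : ℝ} (hB : ∀ I, ‖ε I‖ ≤ B) {η : ℝ}
    (hη : 0 < η) : ∃ γ : ℝ, 0 < γ ∧ ∀ f : Fin m → ℝ → 𝕜,
      (∀ j, ∀ I : DyadicInterval, IntegrableOn (f j) I.toSet) →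
      ∀ (F : Finset DyadicInterval) (s : ℝ), 0 < s →
        volume {x | ENNReal.ofReal (3 * s) < maximalSum (haarTerm ε α f) F x}
          ≤ ENNReal.ofReal η * volume {x | ENNReal.ofReal s < maximalSum (haarTerm ε α f) F x}
            + volume {x | ENNReal.ofReal (γ * s) < ∏ j, maximal (f j) x} := by
  obtain ⟨γ, hγ, h⟩ := exists_good_lambda hα hB hη
  refine ⟨γ, hγ, fun f hf F s hs => ?_⟩
  refine le_trans (measure_mono fun x hx => ?_) ((measure_union_le _ _).trans
    (add_le_add_left (h f hf F s hs) _))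
  by_cases hY : ∏ j, maximal (f j) x ≤ ENNReal.ofReal (γ * s)
  · exact Or.inl ⟨hx, hY⟩
  · exact Or.inr (not_le.1 hY)

theorem le_two_mul_of_le_half_add {a b : ℝ≥0∞} (ha : a ≠ ∞) (h : a ≤ 2⁻¹ * a + b) :
    a ≤ 2 * b := by
  have h2 : 2⁻¹ * a + 2⁻¹ * a = a := by
    rw [← add_mul, ENNReal.inv_two_add_inv_two, one_mul]
  have h3 : 2⁻¹ * a ≤ b := by
    have h4 : 2⁻¹ * a + 2⁻¹ * a ≤ 2⁻¹ * a + b := h2.le.trans h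
    exact (ENNReal.add_le_add_iff_left (ENNReal.mul_ne_top (by simp) ha)).1 h4
  calc a = 2 * (2⁻¹ * a) := by
        rw [← mul_assoc, ENNReal.mul_inv_cancel (by simp) (by simp), one_mul]
    _ ≤ 2 * b := by gcongr

/-- The maximal partial sums are controlled in weak `L^r` by the product of the maximal
functions. -/
theorem exists_maximalSum_weak_le (hα : α ∈ U m) {B : ℝ} (hB : ∀ I, ‖ε I‖ ≤ B) {r : ℝ}
    (hr : 0 < r) : ∃ C : ℝ≥0, ∀ f : Fin m → ℝ → 𝕜,
      (∀ j, ∀ I : DyadicInterval, IntegrableOn (f j) I.toSet) →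
      ∀ N : ℝ≥0∞, (∀ s : ℝ, 0 < s → ENNReal.ofReal s ^ r *
        volume {x | ENNReal.ofReal s < ∏ j, maximal (f j) x} ≤ N) →
      ∀ (F : Finset DyadicInterval) (s : ℝ), 0 < s → ENNReal.ofReal s ^ r *
        volume {x | ENNReal.ofReal s < maximalSum (haarTerm ε α f) F x} ≤ C * N := by
  -- Passing from level `s` to `s / 3` costs a factor `3 ^ r`; this `η` makes the resulting
  -- coefficient `1 / 2`.
  have hη : (0 : ℝ) < (3 ^ r)⁻¹ / 2 := by positivity
  obtain ⟨γ, hγ, h⟩ := exists_meas_lt_maximalSum_le hα hB hη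
  refine ⟨2 * ((3 / γ) ^ r).toNNReal, fun f hf N hN F => ?_⟩
  set X := maximalSum (haarTerm ε α f) F
  set W : ℝ≥0∞ := ⨆ s : {s : ℝ // 0 < s}, ENNReal.ofReal s ^ r *
    volume {x | ENNReal.ofReal s < X x} with hW
  have hWle : ∀ s : ℝ, 0 < s → ENNReal.ofReal s ^ r * volume {x | ENNReal.ofReal s < X x} ≤ W :=
    fun s hs => le_iSup (fun s : {s : ℝ // 0 < s} => ENNReal.ofReal s ^ r *
      volume {x | ENNReal.ofReal s < X x}) ⟨s, hs⟩
  have hWtop : W ≠ ∞ := by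
    obtain ⟨C, hC⟩ := exists_maximalSum_le hα ε f F
    have hle : W ≤ (C : ℝ≥0∞) ^ r * volume (⋃ I ∈ F, I.toSet) := by
      refine iSup_le fun ⟨s, hs⟩ => ?_
      simp only
      rcases lt_or_ge (ENNReal.ofReal s) C with hsC | hsC
      · refine mul_le_mul' (ENNReal.rpow_le_rpow hsC.le hr.le) (measure_mono fun x hx => ?_)
        by_contra hxF
        have := hC _ |>.trans_eq (Set.indicator_of_notMem hxF _)
        exact absurd (lt_of_lt_of_le hx this) not_lt_zero
      · have : {x | ENNReal.ofReal s < X x} = ∅ := by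
          ext x
          simp only [Set.mem_ofPred_eq, Set.mem_empty_iff_false, iff_false, not_lt]
          exact ((hC x).trans (Set.indicator_le_self' (fun _ _ => zero_le) x)).trans hsC
        simp [this]
    exact (hle.trans_lt (ENNReal.mul_lt_top (ENNReal.rpow_lt_top_of_nonneg hr.le (by simp))
      (volume_biUnion_toSet_ne_top F).lt_top)).ne
  have hmain : W ≤ 2⁻¹ * W + ENNReal.ofReal ((3 / γ) ^ r) * N := by
    refine iSup_le fun ⟨s, hs⟩ => ?_
    simp only
    have h1 := h f hf F (s / 3) (by positivity)
    rw [mul_div_cancel₀ s (by norm_num : (3 : ℝ) ≠ 0)] at h1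
    refine (mul_le_mul_right h1 _).trans ?_
    rw [mul_add]
    refine add_le_add ?_ ?_
    · have h2 := hWle (s / 3) (by positivity)
      calc _ = 2⁻¹ * (ENNReal.ofReal (s / 3) ^ r * volume {x | ENNReal.ofReal (s / 3) < X x}) := by
            rw [← mul_assoc, ← mul_assoc]
            congr 1
            rw [ENNReal.ofReal_rpow_of_pos hs, ENNReal.ofReal_rpow_of_pos (by positivity),
              ← ENNReal.ofReal_mul (by positivity), Real.div_rpow hs.le (by norm_num),
              show (2 : ℝ≥0∞)⁻¹ = ENNReal.ofReal (2⁻¹) by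
                rw [ENNReal.ofReal_inv_of_pos (by norm_num)]; simp,
              ← ENNReal.ofReal_mul (by norm_num)]
            congr 1
            ring
        _ ≤ _ := by gcongr
    · have h2 := hN (γ * (s / 3)) (by positivity)
      calc _ = ENNReal.ofReal ((3 / γ) ^ r) * (ENNReal.ofReal (γ * (s / 3)) ^ r *
              volume {x | ENNReal.ofReal (γ * (s / 3)) < ∏ j, maximal (f j) x}) := by
            rw [← mul_assoc]
            congr 1
            rw [ENNReal.ofReal_rpow_of_pos hs, ENNReal.ofReal_rpow_of_pos (by positivity),
              ← ENNReal.ofReal_mul (by positivity), ← Real.mul_rpow (by positivity) (by positivity)]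
            congr 2
            field_simp
        _ ≤ _ := by gcongr
  intro s hs
  refine (hWle s hs).trans ((le_two_mul_of_le_half_add hWtop hmain).trans (le_of_eq ?_))
  rw [← mul_assoc]
  congr 1

/-- The maximal partial sums are controlled in `L^r` by the product of the maximal functions. -/
theorem exists_maximalSum_strong_le (hα : α ∈ U m) {B : ℝ} (hB : ∀ I, ‖ε I‖ ≤ B) {r : ℝ}
    (hr : 0 < r) : ∃ C : ℝ≥0, ∀ f : Fin m → ℝ → 𝕜,
      (∀ j, ∀ I : DyadicInterval, IntegrableOn (f j) I.toSet) →
      ∀ F : Finset DyadicInterval, ∫⁻ x, maximalSum (haarTerm ε α f) F x ^ r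
        ≤ C * ∫⁻ x, (∏ j, maximal (f j) x) ^ r := by
  have hη : (0 : ℝ) < (3 ^ r)⁻¹ / 2 := by positivity
  obtain ⟨γ, hγ, h⟩ := exists_meas_lt_maximalSum_le hα hB hη
  -- The summand `1` keeps the constant nonzero, so that the bound is trivial when the right-hand
  -- integral is infinite.
  refine ⟨2 * ((3 / γ) ^ r).toNNReal + 1, fun f hf F => ?_⟩
  set X := maximalSum (haarTerm ε α f) F with hX
  have hYm : Measurable fun x => ∏ j, maximal (f j) x :=
    Finset.measurable_fun_prod _ fun j _ => measurable_maximal (f j)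
  have hXm : Measurable X := measurable_maximalSum F
  by_cases hYtop : ∫⁻ x, (∏ j, maximal (f j) x) ^ r = ∞
  · rw [hYtop, ENNReal.mul_top (by simp)]
    exact le_top
  have hYfin : ∀ᵐ x, ∏ j, maximal (f j) x < ∞ := by
    filter_upwards [ae_lt_top (hYm.pow_const r) hYtop] with x hx
    exact (ENNReal.rpow_lt_top_iff_of_pos hr).1 hx
  obtain ⟨C, hC⟩ := exists_maximalSum_le hα ε f F
  have hXfin : ∀ x, X x < ∞ := fun x =>
    ((hC x).trans (Set.indicator_le_self' (fun _ _ => zero_le) x)).trans_lt ENNReal.coe_lt_top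
  have hXint : ∫⁻ x, X x ^ r ≠ ∞ := by
    have hle : ∫⁻ x, X x ^ r ≤ ∫⁻ x, (⋃ I ∈ F, I.toSet).indicator
        (fun _ => (C : ℝ≥0∞) ^ r) x := by
      refine lintegral_mono fun x => ?_
      refine (ENNReal.rpow_le_rpow (hC x) hr.le).trans (le_of_eq ?_)
      by_cases hx : x ∈ ⋃ I ∈ F, I.toSet <;> simp [hx, hr, -Set.mem_iUnion]
    rw [lintegral_indicator_const
      (Finset.measurableSet_biUnion F fun I _ => I.measurableSet_toSet)] at hle
    exact (hle.trans_lt (ENNReal.mul_lt_top (ENNReal.rpow_lt_top_of_nonneg hr.le (by simp))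
      (volume_biUnion_toSet_ne_top F).lt_top)).ne
  have hscale : ∀ (c : ℝ), 0 < c → ∀ (t : ℝ) (y : ℝ≥0∞),
      ENNReal.ofReal t < (ENNReal.ofReal c)⁻¹ * y ↔ ENNReal.ofReal (c * t) < y := by
    intro c hc t y
    rw [ENNReal.ofReal_mul hc.le, mul_comm (ENNReal.ofReal c)⁻¹, ← div_eq_mul_inv,
      ENNReal.lt_div_iff_mul_lt (Or.inl (by simpa using hc)) (Or.inl (by simp)), mul_comm]
  have hmul : ∀ c : ℝ, 0 < c → ∀ u : ℝ → ℝ≥0∞, Measurable u →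
      ∫⁻ x, ((ENNReal.ofReal c)⁻¹ * u x) ^ r = ENNReal.ofReal ((c ^ r)⁻¹) * ∫⁻ x, u x ^ r := by
    intro c hc u hu
    simp_rw [ENNReal.mul_rpow_of_nonneg _ _ hr.le]
    rw [lintegral_const_mul _ (hu.pow_const r), ENNReal.inv_rpow,
      ENNReal.ofReal_rpow_of_pos hc, ENNReal.ofReal_inv_of_pos (by positivity)]
  have hinv : ∀ c : ℝ, 0 < c → (ENNReal.ofReal c)⁻¹ < ∞ := fun c hc => by
    simpa using hc
  -- The factors `3` and `γ` are moved from the levels into the functions, so that all three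
  -- distribution functions are taken at the same `t`.
  have hmain := lintegral_rpow_le_of_meas_lt_le (g := fun x => (ENNReal.ofReal 3)⁻¹ * X x)
    (h₁ := X) (h₂ := fun x => (ENNReal.ofReal γ)⁻¹ * ∏ j, maximal (f j) x)
    (hXm.const_mul _).aemeasurable hXm.aemeasurable (hYm.const_mul _).aemeasurable
    (Eventually.of_forall fun x => ENNReal.mul_lt_top (hinv 3 (by norm_num)) (hXfin x))
    (Eventually.of_forall hXfin) (hYfin.mono fun x hx => ENNReal.mul_lt_top (hinv γ hγ) hx) hr
    (fun t ht => by
      simp_rw [hscale 3 (by norm_num), hscale γ hγ]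
      exact h f hf F t ht)
  rw [hmul 3 (by norm_num) X hXm, hmul γ hγ _ hYm] at hmain
  have h3 : (∫⁻ x, X x ^ r) ≤ 2⁻¹ * (∫⁻ x, X x ^ r)
      + ENNReal.ofReal ((3 / γ) ^ r) * ∫⁻ x, (∏ j, maximal (f j) x) ^ r := by
    calc (∫⁻ x, X x ^ r) = ENNReal.ofReal (3 ^ r) *
          (ENNReal.ofReal ((3 ^ r)⁻¹) * ∫⁻ x, X x ^ r) := by
            rw [← mul_assoc, ← ENNReal.ofReal_mul (by positivity),
              mul_inv_cancel₀ (by positivity), ENNReal.ofReal_one, one_mul]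
      _ ≤ _ := mul_le_mul_right hmain _
      _ = _ := by
          rw [mul_add, ← mul_assoc, ← mul_assoc, ← ENNReal.ofReal_mul (by positivity),
            ← ENNReal.ofReal_mul (by positivity), mul_div_assoc', mul_inv_cancel₀ (by positivity),
            Real.div_rpow (by norm_num) hγ.le, ← div_eq_mul_inv,
            show (2 : ℝ≥0∞)⁻¹ = ENNReal.ofReal (1 / 2) by
              rw [one_div, ENNReal.ofReal_inv_of_pos (by norm_num)]; simp]
  refine (le_two_mul_of_le_half_add hXint h3).trans ?_
  rw [← mul_assoc]
  gcongr
  push_cast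
  exact le_self_add

end

/-! ### The dyadic maximal function and products of maximal functions -/

section

variable {𝕜 : Type*} [RCLike 𝕜]

theorem avg_congr {f g : ℝ → 𝕜} (h : f =ᵐ[volume] g) (I : DyadicInterval) : avg f I = avg g I := by
  unfold avg
  congr 1
  refine integral_congr_ae (ae_restrict_of_ae (h.mono fun x hx => ?_))
  simp only [hx]

theorem maximal_congr {f g : ℝ → 𝕜} (h : f =ᵐ[volume] g) : maximal f = maximal g := by
  funext x
  simp only [maximal, avg_congr h]

theorem integrableOn_toSet {f : ℝ → 𝕜} {p : ℝ≥0∞} (hp : 1 ≤ p) (hf : MemLp f p)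
    (I : DyadicInterval) : IntegrableOn f I.toSet :=
  (hf.locallyIntegrable hp).integrableOn_isCompact isCompact_Icc |>.mono_set
    (Set.Ico_subset_Icc_self (a := I.left + I.len) (b := I.left))

theorem one_le_toReal {p : ℝ≥0∞} (hp : 1 ≤ p) (hp' : p < ∞) : 1 ≤ p.toReal := by
  rw [← ENNReal.toReal_one]
  exact ENNReal.toReal_mono hp'.ne hp

/-- Jensen's inequality on `I`, obtained by comparing the `L¹` and `L^p` norms on a set of finite
measure. -/
theorem ofReal_avg_rpow_mul_le {f : ℝ → 𝕜} {p : ℝ≥0∞} (hp : 1 ≤ p) (hp' : p < ∞)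
    (hf : MemLp f p) (I : DyadicInterval) :
    ENNReal.ofReal (avg f I) ^ p.toReal * volume I.toSet
      ≤ ∫⁻ x in I.toSet, ‖f x‖ₑ ^ p.toReal := by
  have hp1 := one_le_toReal hp hp'
  have hp0 : 0 < p.toReal := by linarith
  have h := eLpNorm_le_eLpNorm_mul_rpow_measure_univ hp hf.aestronglyMeasurable.restrict
    (μ := volume.restrict I.toSet)
  rw [eLpNorm_one_eq_lintegral_enorm, setLIntegral_enorm_eq (integrableOn_toSet hp hf I),
    Measure.restrict_apply_univ, ENNReal.ofReal_mul (avg_nonneg _ _), ← volume_toSet,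
    eLpNorm_eq_lintegral_rpow_enorm_toReal (by positivity) hp'.ne] at h
  have h2 := ENNReal.rpow_le_rpow h hp0.le
  rw [ENNReal.mul_rpow_of_nonneg _ _ hp0.le, ENNReal.mul_rpow_of_nonneg _ _ hp0.le,
    ← ENNReal.rpow_mul, one_div_mul_cancel hp0.ne', ENNReal.rpow_one, ← ENNReal.rpow_mul,
    ENNReal.toReal_one, div_one, sub_mul, one_mul, one_div_mul_cancel hp0.ne',
    ENNReal.rpow_sub _ _ I.volume_ne_zero I.volume_ne_top, ENNReal.rpow_one] at h2
  have hV0 : volume I.toSet ^ p.toReal ≠ 0 := by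
    simp [ENNReal.rpow_eq_zero_iff, I.volume_ne_zero, I.volume_ne_top]
  have hV1 : volume I.toSet ^ p.toReal ≠ ∞ :=
    ENNReal.rpow_ne_top_of_nonneg hp0.le I.volume_ne_top
  rw [mul_div_assoc', ENNReal.le_div_iff_mul_le (Or.inl I.volume_ne_zero)
    (Or.inl I.volume_ne_top), mul_right_comm] at h2
  exact (ENNReal.mul_le_mul_iff_left hV0 hV1).1 h2

theorem eLpNorm_rpow_toReal {f : ℝ → 𝕜} {p : ℝ≥0∞} (hp0 : p ≠ 0) (hp' : p ≠ ∞)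
    {μ : Measure ℝ} : eLpNorm f p μ ^ p.toReal = ∫⁻ x, ‖f x‖ₑ ^ p.toReal ∂μ := by
  have := ENNReal.toReal_pos hp0 hp'
  rw [eLpNorm_eq_lintegral_rpow_enorm_toReal hp0 hp', ← ENNReal.rpow_mul,
    one_div_mul_cancel this.ne', ENNReal.rpow_one]

theorem setOf_lt_maximal (f : ℝ → 𝕜) {s : ℝ} (hs : 0 ≤ s) :
    {x | ENNReal.ofReal s < maximal f x} = ⋃ I ∈ {I : DyadicInterval | s < avg f I}, I.toSet := by
  ext x
  simp only [maximal, Set.mem_ofPred_eq, lt_iSup_iff, Set.mem_iUnion, exists_prop]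
  constructor
  · rintro ⟨k, hk⟩
    exact ⟨cube k x, (ENNReal.ofReal_lt_ofReal_iff_of_nonneg hs).1 hk, mem_cube k x⟩
  · rintro ⟨I, hI, hx⟩
    refine ⟨I.scale, ?_⟩
    rw [mem_toSet_iff.1 hx]
    exact (ENNReal.ofReal_lt_ofReal_iff_of_nonneg hs).2 hI

/-- The weak type `(p, p)` estimate of the dyadic maximal function. -/
theorem maximal_weak_le {f : ℝ → 𝕜} {p : ℝ≥0∞} (hp : 1 ≤ p) (hp' : p < ∞)
    (hf : MemLp f p) {s : ℝ} (hs : 0 < s) :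
    ENNReal.ofReal s ^ p.toReal * volume {x | ENNReal.ofReal s < maximal f x}
      ≤ eLpNorm f p volume ^ p.toReal := by
  rw [setOf_lt_maximal f hs.le, eLpNorm_rpow_toReal (by positivity) hp'.ne]
  have h := measure_biUnion_le (Q := {I : DyadicInterval | s < avg f I})
    (μ := ENNReal.ofReal s ^ p.toReal • volume)
    (ν := volume.withDensity fun x => ‖f x‖ₑ ^ p.toReal) (fun I hI => by
      rw [Measure.smul_apply, smul_eq_mul, withDensity_apply _ I.measurableSet_toSet]
      refine le_trans ?_ (ofReal_avg_rpow_mul_le hp hp' hf I)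
      have : s ≤ avg f I := le_of_lt hI
      gcongr)
  refine h.trans ((measure_mono (Set.subset_univ _)).trans (le_of_eq ?_))
  rw [withDensity_apply _ MeasurableSet.univ, Measure.restrict_univ]

theorem maximal_ae_lt_top {f : ℝ → 𝕜} {p : ℝ≥0∞} (hp : 1 ≤ p) (hp' : p < ∞)
    (hf : MemLp f p) : ∀ᵐ x, maximal f x < ∞ :=
  ae_lt_top_of_weak (lt_of_lt_of_le one_pos (one_le_toReal hp hp'))
    (ENNReal.rpow_ne_top_of_nonneg ENNReal.toReal_nonneg hf.eLpNorm_ne_top)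
    fun _ hs => maximal_weak_le hp hp' hf hs

/-- On an interval with average above `2 s`, the part where `|f| ≤ s` carries at most `s |I|`, hence
the part where `|f| > s` carries at least `s |I|`. Keeping only this large part makes integration
over the levels possible for `p > 1`. -/
theorem volume_lt_maximal_le {f : ℝ → 𝕜} (hfm : StronglyMeasurable f)
    (hf : ∀ I : DyadicInterval, IntegrableOn f I.toSet) {s : ℝ} (hs : 0 < s) :
    ENNReal.ofReal s * volume {x | ENNReal.ofReal (2 * s) < maximal f x}
      ≤ volume.withDensity (fun x => ‖f x‖ₑ) {x | ENNReal.ofReal s < ‖f x‖ₑ} := by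
  have hA : MeasurableSet {x | ENNReal.ofReal s < ‖f x‖ₑ} :=
    measurableSet_lt measurable_const hfm.measurable.enorm
  set A := {x | ENNReal.ofReal s < ‖f x‖ₑ} with hAdef
  rw [setOf_lt_maximal f (by positivity)]
  have h := measure_biUnion_le (Q := {I : DyadicInterval | 2 * s < avg f I})
    (μ := ENNReal.ofReal s • volume)
    (ν := (volume.withDensity fun x => ‖f x‖ₑ).restrict A) (fun I hI => by
      rw [Measure.smul_apply, smul_eq_mul, Measure.restrict_apply I.measurableSet_toSet,
        withDensity_apply _ (I.measurableSet_toSet.inter hA)]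
      have h1 : ENNReal.ofReal (2 * s) * volume I.toSet ≤ ∫⁻ x in I.toSet, ‖f x‖ₑ := by
        rw [setLIntegral_enorm_eq (hf I), ENNReal.ofReal_mul (avg_nonneg f I), volume_toSet]
        gcongr
        exact le_of_lt hI
      have h2 : ∫⁻ x in I.toSet, ‖f x‖ₑ ≤ ENNReal.ofReal s * volume I.toSet
          + ∫⁻ x in I.toSet ∩ A, ‖f x‖ₑ := by
        rw [Set.inter_comm, ← Measure.restrict_restrict hA, ← lintegral_indicator hA,
          ← setLIntegral_const, ← lintegral_add_left measurable_const]
        refine lintegral_mono fun x => ?_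
        by_cases hx : x ∈ A
        · simp [hx]
        · simpa [hx] using not_lt.1 hx
      have h3 : ENNReal.ofReal (2 * s) = ENNReal.ofReal s + ENNReal.ofReal s := by
        rw [two_mul, ENNReal.ofReal_add hs.le hs.le]
      have h4 := h1.trans h2
      rw [h3, add_mul] at h4
      exact (ENNReal.add_le_add_iff_left
        (ENNReal.mul_ne_top ENNReal.ofReal_ne_top I.volume_ne_top)).1 h4)
  refine h.trans ?_
  rw [Measure.restrict_apply (MeasurableSet.biUnion (Set.to_countable _)
    fun I _ => I.measurableSet_toSet)]
  exact measure_mono Set.inter_subset_right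

/-- The strong type `(p, p)` estimate of the dyadic maximal function. -/
theorem exists_maximal_strong_le {p : ℝ≥0∞} (hp : 1 < p) (hp' : p < ∞) :
    ∃ C : ℝ≥0, ∀ f : ℝ → 𝕜, MemLp f p → ∫⁻ x, maximal f x ^ p.toReal
      ≤ C * eLpNorm f p volume ^ p.toReal := by
  set q := p.toReal with hq
  have hq1 : 1 < q := by
    rw [hq, ← ENNReal.toReal_one]
    exact ENNReal.toReal_strict_mono hp'.ne hp
  refine ⟨(2 ^ q * (q / (q - 1))).toNNReal, fun f hf => ?_⟩
  obtain ⟨g, hgm, hfg⟩ := hf.aestronglyMeasurable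
  rw [maximal_congr hfg, eLpNorm_congr_ae hfg, eLpNorm_rpow_toReal (by positivity) hp'.ne]
  replace hf : MemLp g p := hf.ae_eq hfg
  have hgi := integrableOn_toSet hp.le hf
  have hfin := maximal_ae_lt_top hp.le hp' hf
  have hm := measurable_maximal g
  set ν := volume.withDensity fun x => ‖g x‖ₑ with hν
  have hge : Measurable fun x => ‖g x‖ₑ := hgm.measurable.enorm
  have h2 : ∀ (t : ℝ), {x | ENNReal.ofReal t < 2⁻¹ * maximal g x}
      = {x | ENNReal.ofReal (2 * t) < maximal g x} := by
    intro t
    ext x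
    simp only [Set.mem_ofPred_eq]
    rw [mul_comm (2 : ℝ≥0∞)⁻¹, ← div_eq_mul_inv, ENNReal.lt_div_iff_mul_lt (by simp) (by simp),
      mul_comm, ENNReal.ofReal_mul (by norm_num), ENNReal.ofReal_ofNat]
  have h3 : ∫⁻ x, maximal g x ^ q = ENNReal.ofReal (2 ^ q) * ∫⁻ x, (2⁻¹ * maximal g x) ^ q := by
    rw [← lintegral_const_mul _ ((hm.const_mul _).pow_const q)]
    refine lintegral_congr fun x => ?_
    rw [ENNReal.mul_rpow_of_nonneg _ _ (by linarith), ← mul_assoc,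
      ← ENNReal.ofReal_rpow_of_pos (by norm_num), ENNReal.ofReal_ofNat,
      ← ENNReal.mul_rpow_of_nonneg _ _ (by linarith), ENNReal.mul_inv_cancel (by simp) (by simp),
      ENNReal.one_rpow, one_mul]
  -- One power of `|g|` is put into the measure `ν`, so the layer-cake formula with exponent `q - 1`
  -- matches the right side of the truncated weak bound.
  have h4 : ∫⁻ x, ‖g x‖ₑ ^ q = ∫⁻ x, ‖g x‖ₑ ^ (q - 1) ∂ν := by
    rw [hν, lintegral_withDensity_eq_lintegral_mul _ hge (hge.pow_const _)]
    refine lintegral_congr fun x => ?_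
    rw [Pi.mul_apply]
    conv_rhs => enter [1]; rw [← ENNReal.rpow_one ‖g x‖ₑ]
    rw [← ENNReal.rpow_add_of_nonneg _ _ zero_le_one (by linarith), add_sub_cancel]
  rw [h3, h4, lintegral_rpow_eq_lintegral_meas_lt (hm.const_mul _).aemeasurable
      (hfin.mono fun x hx => ENNReal.mul_lt_top (by simp) hx) (by linarith)
      Measure.AbsolutelyContinuous.rfl,
    lintegral_rpow_eq_lintegral_meas_lt hge.aemeasurable
      (Eventually.of_forall fun x => enorm_lt_top) (sub_pos.2 hq1)
      (withDensity_absolutelyContinuous _ _)]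
  have h5 : ∫⁻ t in Set.Ioi (0 : ℝ), volume {x | ENNReal.ofReal t < 2⁻¹ * maximal g x}
        * ENNReal.ofReal (t ^ (q - 1))
      ≤ ∫⁻ t in Set.Ioi (0 : ℝ), ν {x | ENNReal.ofReal t < ‖g x‖ₑ}
        * ENNReal.ofReal (t ^ (q - 1 - 1)) := by
    refine setLIntegral_mono' measurableSet_Ioi fun t ht => ?_
    have ht' : 0 < t := ht
    rw [h2, show t ^ (q - 1) = t * t ^ (q - 1 - 1) by
      rw [Real.rpow_sub_one ht'.ne' (q - 1)]; field_simp, ENNReal.ofReal_mul ht'.le, ← mul_assoc,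
      mul_comm (volume _)]
    gcongr
    exact volume_lt_maximal_le hgm hgi ht'
  refine (mul_le_mul_right (mul_le_mul_right h5 _) _).trans (le_of_eq ?_)
  rw [← mul_assoc, ← mul_assoc]
  congr 1
  change _ = ENNReal.ofReal _ * _
  rw [← ENNReal.ofReal_mul (by positivity), ← ENNReal.ofReal_mul
    (mul_nonneg (by positivity) (div_nonneg (by linarith) (by linarith)))]
  congr 1
  have : q - 1 ≠ 0 := by linarith
  field_simp

variable {m : ℕ} {f : Fin m → ℝ → 𝕜} {p : Fin m → ℝ≥0∞} {r : ℝ}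

/-- Hölder's inequality with weights `r / p j`, applied to the `p j`-th powers of the maximal
functions; it does not need `r ≥ 1`. -/
theorem prod_maximal_strong_le (hp : ∀ j, 1 < p j ∧ p j < ∞) (hr : 0 < r)
    (hpr : ∑ j, r / (p j).toReal = 1) : ∃ C : ℝ≥0, ∀ f : Fin m → ℝ → 𝕜, (∀ j, MemLp (f j) (p j)) →
    ∫⁻ x, (∏ j, maximal (f j) x) ^ r ≤ C * (∏ j, eLpNorm (f j) (p j) volume) ^ r := by
  choose C hC using fun j => exists_maximal_strong_le (𝕜 := 𝕜) (hp j).1 (hp j).2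
  have hp0 : ∀ j, 0 < (p j).toReal := fun j =>
    lt_of_lt_of_le one_pos (one_le_toReal (hp j).1.le (hp j).2)
  refine ⟨∏ j, (C j) ^ (r / (p j).toReal), fun f hf => ?_⟩
  have hcomb : ∀ (j : Fin m) (y : ℝ≥0∞), (y ^ (p j).toReal) ^ (r / (p j).toReal) = y ^ r := by
    intro j y
    rw [← ENNReal.rpow_mul, mul_div_cancel₀ _ (hp0 j).ne']
  have h1 := ENNReal.lintegral_prod_norm_pow_le (μ := volume) Finset.univ
    (f := fun j x => maximal (f j) x ^ (p j).toReal)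
    (fun j _ => ((measurable_maximal (f j)).pow_const _).aemeasurable) hpr
    (fun j _ => div_nonneg hr.le (hp0 j).le)
  simp_rw [hcomb] at h1
  simp_rw [← ENNReal.prod_rpow_of_nonneg hr.le]
  refine h1.trans ?_
  rw [ENNReal.ofNNReal_finsetProd, ← Finset.prod_mul_distrib]
  refine Finset.prod_le_prod' fun j _ => ?_
  rw [ENNReal.coe_rpow_of_nonneg _ (div_nonneg hr.le (hp0 j).le)]
  refine (ENNReal.rpow_le_rpow (hC j (f j) (hf j)) (div_nonneg hr.le (hp0 j).le)).trans
    (le_of_eq ?_)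
  rw [ENNReal.mul_rpow_of_nonneg _ _ (div_nonneg hr.le (hp0 j).le), hcomb]

theorem maximal_eq_zero {f : ℝ → 𝕜} (h : f =ᵐ[volume] 0) : maximal f = 0 := by
  rw [maximal_congr h]
  funext x
  simp [maximal, avg]

/-- Hölder's inequality in the weak spaces, for the product of the maximal functions. -/
theorem prod_maximal_weak_le (hp : ∀ j, 1 ≤ p j ∧ p j < ∞)
    (hpr : ∑ j, r / (p j).toReal = 1) (hf : ∀ j, MemLp (f j) (p j)) {s : ℝ} (hs : 0 < s) :
    ENNReal.ofReal s ^ r * volume {x | ENNReal.ofReal s < ∏ j, maximal (f j) x}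
      ≤ m * (∏ j, eLpNorm (f j) (p j) volume) ^ r := by
  have hp0 : ∀ j, 0 < (p j).toReal := fun j =>
    lt_of_lt_of_le one_pos (one_le_toReal (hp j).1 (hp j).2)
  by_cases hzero : ∃ j, eLpNorm (f j) (p j) volume = 0
  · obtain ⟨j, hj⟩ := hzero
    have h0 : f j =ᵐ[volume] 0 := (eLpNorm_eq_zero_iff (hf j).aestronglyMeasurable
      (by have := (hp j).1; positivity)).1 hj
    have : ∀ x, ∏ j, maximal (f j) x = 0 := fun x =>
      Finset.prod_eq_zero (Finset.mem_univ j) (by rw [maximal_eq_zero h0]; rfl)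
    simp [this]
  push Not at hzero
  set a : Fin m → ℝ := fun j => (eLpNorm (f j) (p j) volume).toReal with ha
  have ha0 : ∀ j, 0 < a j := fun j => ENNReal.toReal_pos (hzero j) (hf j).eLpNorm_ne_top
  have haE : ∀ j, eLpNorm (f j) (p j) volume = ENNReal.ofReal (a j) := fun j =>
    (ENNReal.ofReal_toReal (hf j).eLpNorm_ne_top).symm
  have hP : 0 < ∏ j, a j := Finset.prod_pos fun j _ => ha0 j
  -- The level `s` is split into levels `l j` with product `s`, chosen so that `(l j / a j) ^ p j =
  -- (s / ∏ a j) ^ r` for every `j`: all maximal functions then contribute equally.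
  set l : Fin m → ℝ := fun j => a j * (s / ∏ j, a j) ^ (r / (p j).toReal) with hl
  have hl0 : ∀ j, 0 < l j := fun j => mul_pos (ha0 j) (Real.rpow_pos_of_pos (div_pos hs hP) _)
  have hls : ∏ j, l j = s := by
    rw [hl, Finset.prod_mul_distrib, ← Real.rpow_sum_of_pos (div_pos hs hP), hpr, Real.rpow_one,
      mul_div_cancel₀ _ hP.ne']
  have hsub : {x | ENNReal.ofReal s < ∏ j, maximal (f j) x}
      ⊆ ⋃ j, {x | ENNReal.ofReal (l j) < maximal (f j) x} := by
    intro x hx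
    by_contra hcon
    simp only [Set.mem_iUnion, Set.mem_ofPred_eq, not_exists, not_lt] at hcon
    have : ∏ j, maximal (f j) x ≤ ENNReal.ofReal s := by
      rw [← hls, ENNReal.ofReal_prod_of_nonneg fun j _ => (hl0 j).le]
      exact Finset.prod_le_prod' fun j _ => hcon j
    exact absurd hx (not_lt.2 this)
  have hj : ∀ j, ENNReal.ofReal s ^ r * volume {x | ENNReal.ofReal (l j) < maximal (f j) x}
      ≤ (∏ j, eLpNorm (f j) (p j) volume) ^ r := by
    intro j
    have h := maximal_weak_le (hp j).1 (hp j).2 (hf j) (hl0 j)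
    simp_rw [haE] at h ⊢
    rw [← ENNReal.ofReal_prod_of_nonneg fun j _ => (ha0 j).le]
    rw [ENNReal.ofReal_rpow_of_pos (hl0 j), ENNReal.ofReal_rpow_of_pos (ha0 j)] at h
    rw [ENNReal.ofReal_rpow_of_pos hs, ENNReal.ofReal_rpow_of_pos hP]
    have hlp : l j ^ (p j).toReal = a j ^ (p j).toReal * (s ^ r / (∏ j, a j) ^ r) := by
      rw [hl, Real.mul_rpow (ha0 j).le (by positivity), ← Real.rpow_mul (by positivity),
        div_mul_cancel₀ _ (hp0 j).ne', Real.div_rpow hs.le hP.le]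
    have hsr : s ^ r = ((∏ j, a j) ^ r / a j ^ (p j).toReal) * l j ^ (p j).toReal := by
      have := Real.rpow_pos_of_pos (ha0 j) (p j).toReal
      have := Real.rpow_pos_of_pos hP r
      rw [hlp]
      field_simp
    have hc : 0 ≤ (∏ j, a j) ^ r / a j ^ (p j).toReal :=
      div_nonneg (Real.rpow_nonneg hP.le _) (Real.rpow_nonneg (ha0 j).le _)
    rw [hsr, ENNReal.ofReal_mul hc, mul_assoc]
    refine (mul_le_mul_right h _).trans (le_of_eq ?_)
    rw [← ENNReal.ofReal_mul hc, div_mul_cancel₀ _ (Real.rpow_pos_of_pos (ha0 j) _).ne']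
  calc _ ≤ ENNReal.ofReal s ^ r * ∑ j, volume {x | ENNReal.ofReal (l j) < maximal (f j) x} := by
        gcongr
        exact (measure_mono hsub).trans (measure_iUnion_fintype_le _ _)
    _ = ∑ j, ENNReal.ofReal s ^ r * volume {x | ENNReal.ofReal (l j) < maximal (f j) x} :=
        Finset.mul_sum _ _ _
    _ ≤ ∑ _j : Fin m, (∏ j, eLpNorm (f j) (p j) volume) ^ r := Finset.sum_le_sum fun j _ => hj j
    _ = _ := by simp

end

/-! ### Unconditional convergence in measure -/

section

variable {𝕜 : Type*} [RCLike 𝕜]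

/-- A net, indexed by the finite subsets of a countable set, that is Cauchy in measure converges
in measure. -/
theorem exists_tendstoInMeasure_of_cauchy {ι : Type*} {u : Finset ι → ℝ → 𝕜}
    (h : ∀ δ : ℝ, 0 < δ → ∀ e : ℝ≥0∞, 0 < e → ∃ F₀ : Finset ι, ∀ F G : Finset ι, F₀ ⊆ F → F₀ ⊆ G →
      volume {x | δ ≤ ‖u F x - u G x‖} ≤ e) :
    ∃ g : ℝ → 𝕜, TendstoInMeasure volume u atTop g := by
  classical
  choose F₀ hF₀ using fun n : ℕ => h ((1 / 2) ^ n) (by positivity) ((2⁻¹ : ℝ≥0∞) ^ n)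
    (ENNReal.pow_pos (by simp) n)
  -- Increasing finite sets along which the net is Cauchy at rate `2^{-n}`. By Borel–Cantelli the
  -- sequence converges almost everywhere, and its limit is `g`.
  let G : ℕ → Finset ι := fun n => (Finset.range (n + 1)).biUnion F₀
  have hG : ∀ {n k : ℕ}, n ≤ k → F₀ n ⊆ G k := fun {n k} hnk =>
    Finset.subset_biUnion_of_mem F₀ (Finset.mem_range.2 (by omega))
  have hBC : ∀ᵐ x, ∀ᶠ n in atTop,
      x ∉ {x | (1 / 2 : ℝ) ^ n ≤ ‖u (G n) x - u (G (n + 1)) x‖} := by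
    refine ae_eventually_notMem (ne_top_of_le_ne_top ?_ (ENNReal.tsum_le_tsum fun n =>
      hF₀ n (G n) (G (n + 1)) (hG le_rfl) (hG n.le_succ)))
    rw [ENNReal.tsum_geometric]
    simp
  let g : ℝ → 𝕜 := fun x => limUnder atTop fun n => u (G n) x
  have hlim : ∀ᵐ x, Tendsto (fun n => u (G n) x) atTop (nhds (g x)) := by
    filter_upwards [hBC] with x hx
    refine CauchySeq.tendsto_limUnder (cauchySeq_of_summable_dist ?_)
    refine Summable.of_norm_bounded_eventually_nat summable_geometric_two ?_
    filter_upwards [hx] with n hn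
    rw [not_le] at hn
    rw [Real.norm_of_nonneg dist_nonneg, dist_eq_norm]
    exact hn.le
  refine ⟨g, tendstoInMeasure_iff_norm.2 fun δ hδ => ENNReal.tendsto_nhds_zero.2 fun e he => ?_⟩
  obtain ⟨n₁, hn₁⟩ := exists_pow_lt_of_lt_one (half_pos hδ) (by norm_num : (1 / 2 : ℝ) < 1)
  obtain ⟨n₂, hn₂⟩ := ENNReal.exists_inv_two_pow_lt he.ne'
  set n := max n₁ n₂ with hn
  filter_upwards [eventually_ge_atTop (F₀ n)] with F hF
  have hd : (1 / 2 : ℝ) ^ n ≤ δ / 2 :=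
    (pow_le_pow_of_le_one (by norm_num) (by norm_num) (le_max_left _ _)).trans hn₁.le
  have hen : (2⁻¹ : ℝ≥0∞) ^ n ≤ e :=
    (pow_le_pow_of_le_one zero_le (by simp) (le_max_right _ _)).trans hn₂.le
  -- Where `u F` is far from `g`, it is eventually far from `u (G l)`. The increasing union of the
  -- `E k` expresses this, and each `E k` lies in a set controlled by the Cauchy condition.
  let E : ℕ → Set ℝ := fun k => ⋂ l ≥ k, {x | (1 / 2 : ℝ) ^ n ≤ ‖u F x - u (G l) x‖}
  have hEmono : Monotone E := fun a b hab =>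
    Set.biInter_subset_biInter_left fun l (hl : b ≤ l) => hab.trans hl
  have hsub : {x | δ ≤ ‖u F x - g x‖} ≤ᵐ[volume] ⋃ k, E k := by
    filter_upwards [hlim] with x hx hδx
    have hδx' : δ ≤ ‖u F x - g x‖ := hδx
    have h1 : Tendsto (fun l => ‖u F x - u (G l) x‖) atTop (nhds ‖u F x - g x‖) :=
      (tendsto_const_nhds.sub hx).norm
    obtain ⟨k, hk⟩ := eventually_atTop.1
      (h1.eventually (eventually_gt_nhds (show (1 / 2 : ℝ) ^ n < ‖u F x - g x‖ by linarith)))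
    exact Set.mem_iUnion.2 ⟨k, Set.mem_iInter₂.2 fun l hl => (hk l hl).le⟩
  refine (measure_mono_ae hsub).trans ?_
  rw [hEmono.measure_iUnion]
  refine iSup_le fun k => ?_
  refine le_trans (measure_mono (Set.biInter_subset_of_mem (le_max_left k n))) ?_
  exact (hF₀ n F _ hF (hG (le_max_right k n))).trans hen

theorem abs_sub_left_cube_le (k : ℤ) (x : ℝ) : |x - (cube k x).left| ≤ (2 : ℝ) ^ (-k) := by
  have h := mem_cube k x
  have hlen : (cube k x).len = (2 : ℝ) ^ (-k) := rfl
  rw [toSet, hlen] at h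
  rw [abs_of_nonneg (by linarith [h.1])]
  linarith [h.2]

/-- Approximation in `L^p` by dyadic step functions. -/
theorem exists_step_function {f : ℝ → 𝕜} {p : ℝ≥0∞} (hp' : p ≠ ∞)
    (hf : MemLp f p) {θ : ℝ≥0∞} (hθ : θ ≠ 0) :
    ∃ φ : ℝ → 𝕜, MemLp φ p ∧ eLpNorm (f - φ) p volume ≤ θ ∧
      (∃ R : ℝ, ∀ x, R < |x| → φ x = 0) ∧
      ∃ N : ℤ, ∀ I : DyadicInterval, N ≤ I.scale → coeff φ I 0 = 0 := by
  obtain ⟨η, hη, hadd⟩ := exists_Lp_half 𝕜 (volume : Measure ℝ) p hθ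
  obtain ⟨g, hgs, hfg, hgc, hgm⟩ := hf.exists_hasCompactSupport_eLpNorm_sub_le hp' hη.ne'
  obtain ⟨R, hR⟩ : ∃ R : ℝ, ∀ x, R < |x| → g x = 0 := by
    obtain ⟨R, hR⟩ := hgs.isCompact.isBounded.subset_closedBall 0
    refine ⟨R, fun x hx => ?_⟩
    by_contra h
    have := hR (subset_tsupport g h)
    rw [mem_closedBall_zero_iff, Real.norm_eq_abs] at this
    linarith
  have huc := hgs.uniformContinuous_of_continuous hgc
  set V : ℝ≥0∞ := volume (Set.Icc (-(R + 1)) (R + 1)) ^ (1 / p.toReal) with hV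
  have hVtop : V ≠ ∞ := ENNReal.rpow_ne_top_of_nonneg (by positivity) (by simp)
  obtain ⟨τ, hτ, hτV⟩ : ∃ τ : ℝ, 0 < τ ∧ ENNReal.ofReal τ * V ≤ η := by
    obtain ⟨τ, hτ, hle⟩ := ENNReal.exists_nnreal_pos_mul_lt hVtop hη.ne'
    exact ⟨τ, hτ, by rw [ENNReal.ofReal_coe_nnreal]; exact hle.le⟩
  obtain ⟨d, hd, hgd⟩ := Metric.uniformContinuous_iff.1 huc τ hτ
  obtain ⟨N, hN⟩ := exists_pow_lt_of_lt_one (lt_min hd one_pos) (by norm_num : (1 / 2 : ℝ) < 1)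
  have hN' : (2 : ℝ) ^ (-(N : ℤ)) < min d 1 := by
    rw [zpow_neg, zpow_natCast]
    simpa using hN
  -- Sampling the compactly supported continuous `g` at left end points of level `N` makes `φ`
  -- constant on all dyadic intervals of scale at least `N`, so the corresponding Haar coefficients
  -- vanish. The length is below `1`, whence the support bound `R + 1`.
  set φ : ℝ → 𝕜 := fun x => g (cube N x).left with hφ
  have hφm : Measurable φ := by
    have : φ = (fun n : ℤ => g (DyadicInterval.left ⟨n, N⟩)) ∘
        fun x : ℝ => ⌊x * 2 ^ (N : ℤ)⌋ := rfl
    rw [this]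
    exact (measurable_of_countable _).comp (Int.measurable_floor.comp (measurable_id.mul_const _))
  have hdist : ∀ x, ‖g x - φ x‖ ≤ τ := by
    intro x
    rw [← dist_eq_norm]
    refine (hgd ?_).le
    rw [Real.dist_eq]
    exact (abs_sub_left_cube_le N x).trans_lt (hN'.trans_le (min_le_left _ _))
  have hφ0 : ∀ x, R + 1 < |x| → φ x = 0 := by
    intro x hx
    refine hR _ ?_
    have h1 := abs_sub_left_cube_le N x
    have h2 := abs_sub_abs_le_abs_sub x (cube N x).left
    have h3 := hN'.trans_le (min_le_right _ _)
    linarith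
  have hbound : ∀ x, ‖(g - φ) x‖ ≤ ‖(Set.Icc (-(R + 1)) (R + 1)).indicator (fun _ => τ) x‖ := by
    intro x
    rw [Pi.sub_apply]
    by_cases hx : x ∈ Set.Icc (-(R + 1)) (R + 1)
    · rw [Set.indicator_of_mem hx, Real.norm_of_nonneg hτ.le]
      exact hdist x
    · have hx' : R + 1 < |x| := by
        by_contra! h
        exact hx (abs_le.1 h)
      rw [hφ0 x hx', hR x (by linarith)]
      simp
  have hgφ : eLpNorm (g - φ) p volume ≤ η := by
    refine (eLpNorm_mono hbound).trans ((eLpNorm_indicator_const_le _ _).trans ?_)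
    rwa [Real.enorm_of_nonneg hτ.le]
  have hgφm : MemLp (g - φ) p :=
    ⟨hgm.aestronglyMeasurable.sub hφm.aestronglyMeasurable,
      (eLpNorm_mono hbound).trans_lt ((eLpNorm_indicator_const_le _ _).trans_lt
        (ENNReal.mul_lt_top (by simp) hVtop.lt_top))⟩
  have hφp : MemLp φ p := by
    have := hgm.sub hgφm
    rwa [sub_sub_cancel] at this
  refine ⟨φ, hφp, ?_, ⟨R + 1, hφ0⟩, N, fun I hI => ?_⟩
  · have := hadd (f - g) (g - φ) (hf.sub hgm).aestronglyMeasurable hgφm.aestronglyMeasurable hfg hgφ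
    rw [sub_add_sub_cancel] at this
    exact this.le
  · have : ∀ x, φ x * (haar I x : 𝕜) = φ I.left * (haar I x : 𝕜) := by
      intro x
      by_cases hx : x ∈ I.toSet
      · rw [hφ]
        simp only
        rw [cube_eq_of_le hI ((mem_toSet_iff.1 hx).trans (mem_toSet_iff.1 I.left_mem).symm)]
      · simp [haar_of_notMem hx]
    rw [coeff_zero]
    simp_rw [this]
    rw [integral_const_mul, integral_ofReal, integral_haar]
    simp

theorem finite_setOf_scale_and_mem (a b : ℤ) (R : ℝ) :
    {I : DyadicInterval | a ≤ I.scale ∧ I.scale ≤ b ∧ ∃ x ∈ I.toSet, |x| ≤ R}.Finite := by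
  refine (((Set.finite_Icc ⌊-(R * 2 ^ b)⌋ ⌊R * 2 ^ b⌋).prod (Set.finite_Icc a b)).image
    fun q : ℤ × ℤ => (⟨q.1, q.2⟩ : DyadicInterval)).subset ?_
  rintro I ⟨ha, hb, x, hx, hxR⟩
  refine ⟨(I.index, I.scale), ⟨?_, ha, hb⟩, rfl⟩
  have hI : I.index = ⌊x * 2 ^ I.scale⌋ := by
    rw [← mem_toSet_iff.1 hx]; simp [cube]
  have h1 : |x * 2 ^ I.scale| ≤ R * 2 ^ b := by
    rw [abs_mul, abs_of_pos (show (0 : ℝ) < 2 ^ I.scale by positivity)]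
    exact mul_le_mul hxR (zpow_le_zpow_right₀ (by norm_num) hb) (by positivity)
      ((abs_nonneg x).trans hxR)
  rw [abs_le] at h1
  simp only [hI]
  exact ⟨Int.floor_le_floor h1.1, Int.floor_le_floor h1.2⟩

theorem avg_le_eLpNorm {f : ℝ → 𝕜} {p : ℝ≥0∞} (hp : 1 ≤ p) (hp' : p < ∞) (hf : MemLp f p)
    (I : DyadicInterval) :
    avg f I ≤ (eLpNorm f p volume).toReal * I.len ^ (-(1 / p.toReal)) := by
  have hp1 := one_le_toReal hp hp'
  have hp0 : 0 < p.toReal := by linarith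
  have h1 : ENNReal.ofReal (avg f I) ^ p.toReal * volume I.toSet
      ≤ eLpNorm f p volume ^ p.toReal := by
    rw [eLpNorm_rpow_toReal (by positivity) hp'.ne]
    exact (ofReal_avg_rpow_mul_le hp hp' hf I).trans (setLIntegral_le_lintegral _ _)
  set a := (eLpNorm f p volume).toReal with ha
  have ha0 : 0 ≤ a := ENNReal.toReal_nonneg
  rw [← ENNReal.ofReal_toReal hf.eLpNorm_ne_top, ← ha, volume_toSet,
    ENNReal.ofReal_rpow_of_nonneg (avg_nonneg _ _) hp0.le,
    ENNReal.ofReal_rpow_of_nonneg ha0 hp0.le, ← ENNReal.ofReal_mul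
    (Real.rpow_nonneg (avg_nonneg _ _) _), ENNReal.ofReal_le_ofReal_iff (by positivity)] at h1
  have hlen := I.len_pos
  rw [Real.rpow_neg hlen.le, ← div_eq_mul_inv, le_div_iff₀ (by positivity)]
  rw [← Real.rpow_le_rpow_iff (mul_nonneg (avg_nonneg _ _) (by positivity)) ha0 hp0,
    Real.mul_rpow (avg_nonneg _ _) (by positivity), ← Real.rpow_mul hlen.le,
    one_div_mul_cancel hp0.ne', Real.rpow_one]
  exact h1

variable {m : ℕ} {ε : DyadicInterval → 𝕜} {α : Fin m → Fin 2} {p : Fin m → ℝ≥0∞} {r : ℝ}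

/-- The part of the series over long intervals is uniformly small. -/
theorem exists_sum_norm_haarTerm_le (hα : α ∈ U m) {B : ℝ} (hB : ∀ I, ‖ε I‖ ≤ B)
    (hp : ∀ j, 1 ≤ p j ∧ p j < ∞) (hr : 0 < r) (hpr : ∑ j, r / (p j).toReal = 1)
    {f : Fin m → ℝ → 𝕜} (hf : ∀ j, MemLp (f j) (p j)) {δ : ℝ} (hδ : 0 < δ) :
    ∃ n : ℕ, ∀ F : Finset DyadicInterval, (∀ I ∈ F, I.scale ≤ -n) → ∀ x,
      ∑ I ∈ F, ‖haarTerm ε α f I x‖ ≤ δ := by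
  classical
  have hB0 : 0 ≤ B := (norm_nonneg _).trans (hB ⟨0, 0⟩)
  set a : Fin m → ℝ := fun j => (eLpNorm (f j) (p j) volume).toReal with ha
  set D : ℝ := B * ∏ j, a j with hD
  have hD0 : 0 ≤ D := mul_nonneg hB0 (Finset.prod_nonneg fun j _ => ENNReal.toReal_nonneg)
  -- On an interval of length `2^k` the product of the averages is at most `∏ a j` times `|I| ^ (-∑
  -- 1 / p j) = |I| ^ (-1 / r) = q ^ k`.
  set q : ℝ := 2 ^ (-(1 / r)) with hq
  have hq0 : 0 < q := by positivity
  have hq1 : q < 1 := Real.rpow_lt_one_of_one_lt_of_neg (by norm_num) (by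
    rw [neg_lt_zero]; positivity)
  have hterm : ∀ (I : DyadicInterval) (k : ℕ), I.scale = -k → ∀ x,
      ‖haarTerm ε α f I x‖ ≤ D * q ^ k := by
    intro I k hk x
    have hlen := I.len_pos
    have hl : I.len = 2 ^ (k : ℝ) := by rw [len, hk, neg_neg, zpow_natCast, Real.rpow_natCast]
    have hsum : ∑ j, -(1 / (p j).toReal) = -(1 / r) := by
      have h1 : (∑ j, 1 / (p j).toReal) * r = 1 := by
        refine Eq.trans ?_ hpr
        rw [Finset.sum_mul]
        exact Finset.sum_congr rfl fun j _ => by ring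
      rw [Finset.sum_neg_distrib, eq_div_of_mul_eq hr.ne' h1]
    calc _ ≤ B * ∏ j, avg (f j) I := norm_haarTerm_le hα hB I x
      _ ≤ B * ∏ j, (a j * I.len ^ (-(1 / (p j).toReal))) := by
          gcongr with j
          · exact fun j _ => avg_nonneg _ _
          · exact avg_le_eLpNorm (hp j).1 (hp j).2 (hf j) I
      _ = D * q ^ k := by
          rw [Finset.prod_mul_distrib, ← Real.rpow_sum_of_pos hlen, hsum, ← mul_assoc, hl, hq,
            ← Real.rpow_natCast, ← Real.rpow_mul (by norm_num), ← Real.rpow_mul (by norm_num),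
            mul_comm (k : ℝ)]
  obtain ⟨n, hn⟩ := exists_pow_lt_of_lt_one
    (show 0 < δ / (D * (1 - q)⁻¹ + 1) by
      have : 0 < 1 - q := by linarith
      positivity) hq1
  have hs : 0 < 1 - q := by linarith
  refine ⟨n, fun F hF x => ?_⟩
  let e : DyadicInterval → ℕ := fun I => (-I.scale - n).toNat
  have he : ∀ I ∈ F, I.scale = -((n + e I : ℕ) : ℤ) := fun I hI => by
    have := hF I hI
    simp only [e]
    omega
  calc ∑ I ∈ F, ‖haarTerm ε α f I x‖
      = ∑ I ∈ F with x ∈ I.toSet, ‖haarTerm ε α f I x‖ := by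
        refine (Finset.sum_filter_of_ne fun I _ hne => ?_).symm
        by_contra hx
        rw [(isHaarFamily_haarTerm hα ε f).eq_zero I x hx, norm_zero] at hne
        exact hne rfl
    _ ≤ ∑ I ∈ F with x ∈ I.toSet, D * q ^ n * q ^ e I := by
        refine Finset.sum_le_sum fun I hI => ?_
        rw [mul_assoc, ← pow_add]
        exact hterm I _ (he I (Finset.mem_filter.1 hI).1) x
    -- Intervals containing a common point have distinct scales, so the sum is part of a geometric
    -- series.
    _ = D * q ^ n * ∑ k ∈ (F.filter fun I => x ∈ I.toSet).image e, q ^ k := by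
        rw [← Finset.mul_sum, Finset.sum_image]
        intro I hI J hJ hIJ
        have hI' := Finset.mem_filter.1 hI
        have hJ' := Finset.mem_filter.1 hJ
        refine eq_of_mem hI'.2 hJ'.2 ?_
        rw [he I hI'.1, he J hJ'.1, hIJ]
    _ ≤ D * q ^ n * (1 - q)⁻¹ := by
        gcongr
        rw [← tsum_geometric_of_lt_one hq0.le hq1]
        exact (summable_geometric_of_lt_one hq0.le hq1).sum_le_tsum _ fun _ _ => by positivity
    _ ≤ δ := by
        rw [lt_div_iff₀ (by positivity)] at hn
        have : 0 ≤ q ^ n := by positivity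
        nlinarith

theorem coeff_add {f g : ℝ → 𝕜} {I : DyadicInterval} (hf : IntegrableOn f I.toSet)
    (hg : IntegrableOn g I.toSet) (a : Fin 2) :
    coeff (f + g) I a = coeff f I a + coeff g I a := by
  have hint : ∀ {u : ℝ → 𝕜}, IntegrableOn u I.toSet →
      Integrable fun x => u x * (haar I x : 𝕜) := by
    intro u hu
    have h1 : (fun x => u x * (haar I x : 𝕜))
        = fun x => I.toSet.indicator u x * (haar I x : 𝕜) := by
      funext x
      by_cases hx : x ∈ I.toSet <;> simp [hx, haar_of_notMem]
    rw [h1]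
    refine ((integrable_indicator_iff I.measurableSet_toSet).2 hu).mul_bdd
      (c := (Real.sqrt I.len)⁻¹)
      (RCLike.measurable_ofReal.comp (measurable_haar I)).aestronglyMeasurable
      (Eventually.of_forall fun x => ?_)
    simpa using abs_haar_le I x
  unfold coeff
  split_ifs
  · simp_rw [Pi.add_apply, add_mul]
    exact integral_add (hint hf) (hint hg)
  · rw [← mul_add]
    congr 1
    exact integral_add hf hg

theorem prod_update {M : Type*} [CommMonoid M] {A : Type*} (f : Fin m → A) (i : Fin m) (g : A)
    (Φ : Fin m → A → M) : ∏ j, Φ j (Function.update f i g j)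
      = Φ i g * ∏ j ∈ Finset.univ.erase i, Φ j (f j) := by
  rw [← Finset.mul_prod_erase _ _ (Finset.mem_univ i), Function.update_self]
  congr 1
  exact Finset.prod_congr rfl fun j hj => by
    rw [Function.update_of_ne (Finset.ne_of_mem_erase hj)]

theorem haarTerm_update_add {f : Fin m → ℝ → 𝕜} {i : Fin m} {g h : ℝ → 𝕜} {I : DyadicInterval}
    (hg : IntegrableOn g I.toSet) (hh : IntegrableOn h I.toSet) (x : ℝ) :
    haarTerm ε α (Function.update f i (g + h)) I x
      = haarTerm ε α (Function.update f i g) I x + haarTerm ε α (Function.update f i h) I x := by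
  unfold haarTerm
  rw [prod_update f i _ fun j u => coeff u I (α j), prod_update f i _ fun j u => coeff u I (α j),
    prod_update f i _ fun j u => coeff u I (α j), coeff_add hg hh]
  ring

theorem exists_sum_haarTerm_weak_le (hα : α ∈ U m) {B : ℝ} (hB : ∀ I, ‖ε I‖ ≤ B)
    (hp : ∀ j, 1 ≤ p j ∧ p j < ∞) (hr : 0 < r) (hpr : ∑ j, r / (p j).toReal = 1) :
    ∃ C : ℝ≥0, ∀ f : Fin m → ℝ → 𝕜, (∀ j, MemLp (f j) (p j)) →
      ∀ (F : Finset DyadicInterval) (s : ℝ), 0 < s →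
        ENNReal.ofReal s ^ r * volume {x | s < ‖∑ I ∈ F, haarTerm ε α f I x‖}
          ≤ C * (∏ j, eLpNorm (f j) (p j) volume) ^ r := by
  obtain ⟨C, hC⟩ := exists_maximalSum_weak_le hα hB hr
  refine ⟨C * m, fun f hf F s hs => ?_⟩
  have h := hC f (fun j => integrableOn_toSet (hp j).1 (hf j)) _
    (fun s hs => prod_maximal_weak_le hp hpr hf hs) F s hs
  rw [ENNReal.coe_mul, mul_assoc]
  refine le_trans ?_ h
  gcongr with x
  intro hx
  refine lt_of_lt_of_le ?_ (enorm_sum_le_maximalSum _ F x)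
  rw [← ofReal_norm]
  exact (ENNReal.ofReal_lt_ofReal_iff_of_nonneg hs.le).2 hx

theorem exists_pos_mul_rpow_le (hr : 0 < r) (C : ℝ≥0) {P κ : ℝ≥0∞} (hP : P ≠ ∞) (hκ : κ ≠ 0) :
    ∃ θ : ℝ≥0∞, θ ≠ 0 ∧ C * (θ * P) ^ r ≤ κ := by
  refine ⟨(κ / (C + 1)) ^ (1 / r) / (P + 1), ?_, ?_⟩
  · refine (ENNReal.div_pos ?_ (by simp [hP])).ne'
    refine (ENNReal.rpow_pos_of_nonneg (ENNReal.div_pos hκ (by simp)) (by positivity)).ne'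
  · have h1 : (κ / (C + 1)) ^ (1 / r) / (P + 1) * P ≤ (κ / (C + 1)) ^ (1 / r) := by
      calc _ ≤ (κ / (C + 1)) ^ (1 / r) / (P + 1) * (P + 1) := by gcongr; exact le_self_add
        _ ≤ _ := by rw [mul_comm]; exact ENNReal.mul_div_le
    calc _ ≤ (C : ℝ≥0∞) * ((κ / (C + 1)) ^ (1 / r)) ^ r := by gcongr
      _ = C * (κ / (C + 1)) := by
          rw [← ENNReal.rpow_mul, one_div_mul_cancel hr.ne', ENNReal.rpow_one]
      _ ≤ (C + 1) * (κ / (C + 1)) := by gcongr; exact le_self_add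
      _ ≤ κ := ENNReal.mul_div_le

/-- The tails of the series are small in measure. -/
theorem exists_forall_disjoint_measure_le (hα : α ∈ U m) {B : ℝ} (hB : ∀ I, ‖ε I‖ ≤ B)
    (hp : ∀ j, 1 ≤ p j ∧ p j < ∞) (hr : 0 < r) (hpr : ∑ j, r / (p j).toReal = 1)
    {f : Fin m → ℝ → 𝕜} (hf : ∀ j, MemLp (f j) (p j)) {δ : ℝ} (hδ : 0 < δ) {e : ℝ≥0∞}
    (he : 0 < e) : ∃ F₀ : Finset DyadicInterval, ∀ F : Finset DyadicInterval, Disjoint F₀ F →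
      volume {x | 2 * δ < ‖∑ I ∈ F, haarTerm ε α f I x‖} ≤ e := by
  classical
  -- The approximation must take place where `α i = 0`: only then do vanishing Haar coefficients
  -- kill terms of the series.
  obtain ⟨i, hi⟩ : ∃ i, α i = 0 := by
    obtain ⟨i, hi⟩ := Finset.card_pos.1 (sigma_pos hα)
    exact ⟨i, (Finset.mem_filter.1 hi).2⟩
  obtain ⟨C, hC⟩ := exists_sum_haarTerm_weak_le hα hB hp hr hpr
  have hP : ∏ j ∈ Finset.univ.erase i, eLpNorm (f j) (p j) volume ≠ ∞ :=
    ENNReal.prod_ne_top fun j _ => (hf j).eLpNorm_ne_top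
  have hδr : ENNReal.ofReal δ ^ r ≠ 0 :=
    (ENNReal.rpow_pos (by simpa using hδ) (by simp)).ne'
  have hδr' : ENNReal.ofReal δ ^ r ≠ ∞ := ENNReal.rpow_ne_top_of_nonneg hr.le (by simp)
  obtain ⟨θ, hθ, hθle⟩ := exists_pos_mul_rpow_le hr C hP (mul_ne_zero hδr he.ne')
  obtain ⟨φ, hφ, hfφ, ⟨R, hR⟩, N, hN⟩ := exists_step_function (hp i).2.ne (hf i) hθ
  have hupd : ∀ g : ℝ → 𝕜, MemLp g (p i) → ∀ j, MemLp (Function.update f i g j) (p j) := by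
    intro g hg j
    rcases eq_or_ne j i with rfl | hj
    · rwa [Function.update_self]
    · rw [Function.update_of_ne hj]; exact hf j
  have hψ := (hf i).sub hφ
  obtain ⟨n, hn⟩ := exists_sum_norm_haarTerm_le hα hB hp hr hpr (hupd φ hφ) hδ
  -- `F₀` consists of the intervals of intermediate length meeting the region that supports `φ`.
  -- Outside `F₀`, a term of `φ` is nonzero only for a long interval, covered by the choice of `n`.
  refine ⟨(finite_setOf_scale_and_mem (-n) N R).toFinset, fun F hF => ?_⟩
  have hdecomp : ∀ x, ∑ I ∈ F, haarTerm ε α f I x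
      = ∑ I ∈ F, haarTerm ε α (Function.update f i φ) I x
        + ∑ I ∈ F, haarTerm ε α (Function.update f i (f i - φ)) I x := by
    intro x
    rw [← Finset.sum_add_distrib]
    refine Finset.sum_congr rfl fun I _ => ?_
    rw [← haarTerm_update_add (integrableOn_toSet (hp i).1 hφ I)
      (integrableOn_toSet (hp i).1 hψ I), add_sub_cancel, Function.update_eq_self]
  have hφzero : ∀ I ∈ F, -(n : ℤ) < I.scale → ∀ x,
      haarTerm ε α (Function.update f i φ) I x = 0 := by
    intro I hI hs x
    have hc : coeff φ I 0 = 0 := by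
      by_cases hNI : N ≤ I.scale
      · exact hN I hNI
      have hne : I ∉ {I : DyadicInterval | -(n : ℤ) ≤ I.scale ∧ I.scale ≤ N ∧
          ∃ x ∈ I.toSet, |x| ≤ R} := fun h =>
        Finset.disjoint_left.1 hF ((Set.Finite.mem_toFinset _).2 h) hI
      have hvan : ∀ y ∈ I.toSet, φ y = 0 := by
        intro y hy
        refine hR y ?_
        by_contra! hyR
        exact hne ⟨hs.le, (not_le.1 hNI).le, y, hy, hyR⟩
      have : ∀ y, φ y * (haar I y : 𝕜) = 0 := by
        intro y
        by_cases hy : y ∈ I.toSet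
        · rw [hvan y hy, zero_mul]
        · simp [haar_of_notMem hy]
      rw [coeff_zero]
      simp [this]
    rw [haarTerm, prod_update f i _ fun j u => coeff u I (α j), hi, hc]
    simp
  have hφsmall : ∀ x, ‖∑ I ∈ F, haarTerm ε α (Function.update f i φ) I x‖ ≤ δ := by
    intro x
    rw [← Finset.sum_filter_of_ne (p := fun I => I.scale ≤ -(n : ℤ)) fun I hI hne => by
      by_contra! h
      exact hne (hφzero I hI h x)]
    exact (norm_sum_le _ _).trans (hn _ (fun I hI => (Finset.mem_filter.1 hI).2) x)
  have hsub : {x | 2 * δ < ‖∑ I ∈ F, haarTerm ε α f I x‖}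
      ⊆ {x | δ < ‖∑ I ∈ F, haarTerm ε α (Function.update f i (f i - φ)) I x‖} := by
    intro x hx
    have hx' : 2 * δ < ‖∑ I ∈ F, haarTerm ε α f I x‖ := hx
    rw [hdecomp x] at hx'
    have := norm_add_le (∑ I ∈ F, haarTerm ε α (Function.update f i φ) I x)
      (∑ I ∈ F, haarTerm ε α (Function.update f i (f i - φ)) I x)
    have h3 := hφsmall x
    change δ < _
    linarith
  refine (measure_mono hsub).trans ?_
  have hw := hC _ (hupd _ hψ) F δ hδ
  rw [prod_update f i _ fun j u => eLpNorm u (p j) volume] at hw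
  have hw2 := (hw.trans (by gcongr)).trans hθle
  exact (ENNReal.mul_le_mul_iff_right hδr hδr').1 hw2

/-- The series of a Haar multiplier with bounded symbol converges in measure. -/
theorem exists_isHaarMultiplier (hα : α ∈ U m) {B : ℝ} (hB : ∀ I, ‖ε I‖ ≤ B)
    (hp : ∀ j, 1 ≤ p j ∧ p j < ∞) (hr : 0 < r) (hpr : ∑ j, r / (p j).toReal = 1)
    {f : Fin m → ℝ → 𝕜} (hf : ∀ j, MemLp (f j) (p j)) : ∃ g, IsHaarMultiplier ε α f g := by
  classical
  refine exists_tendstoInMeasure_of_cauchy fun δ hδ e he => ?_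
  -- Each of the two differences `F \ G` and `G \ F` is disjoint from `F₀` and contributes at most
  -- `2 * (δ / 8)` off a small set, for a total strictly below `δ`.
  obtain ⟨F₀, hF₀⟩ := exists_forall_disjoint_measure_le hα hB hp hr hpr hf
    (show 0 < δ / 8 by positivity) (ENNReal.half_pos he.ne')
  refine ⟨F₀, fun F G hF hG => ?_⟩
  have hsub : {x | δ ≤ ‖∑ I ∈ F, haarTerm ε α f I x - ∑ I ∈ G, haarTerm ε α f I x‖}
      ⊆ {x | 2 * (δ / 8) < ‖∑ I ∈ F \ G, haarTerm ε α f I x‖} ∪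
        {x | 2 * (δ / 8) < ‖∑ I ∈ G \ F, haarTerm ε α f I x‖} := by
    intro x hx
    have hx' : δ ≤ ‖∑ I ∈ F, haarTerm ε α f I x - ∑ I ∈ G, haarTerm ε α f I x‖ := hx
    by_contra hcon
    simp only [Set.mem_union, Set.mem_ofPred_eq, not_or, not_lt] at hcon
    rw [← Finset.sum_sdiff_sub_sum_sdiff] at hx'
    have := norm_sub_le (∑ I ∈ F \ G, haarTerm ε α f I x) (∑ I ∈ G \ F, haarTerm ε α f I x)
    linarith [hcon.1, hcon.2]
  refine (measure_mono hsub).trans ((measure_union_le _ _).trans ?_)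
  rw [← ENNReal.add_halves e]
  exact add_le_add
    (hF₀ _ (Finset.disjoint_of_subset_left hG Finset.disjoint_sdiff))
    (hF₀ _ (Finset.disjoint_of_subset_left hF Finset.disjoint_sdiff))

end

/-! ### Bounds for the limit, and necessity of a bounded symbol -/

section

variable {𝕜 : Type*} [RCLike 𝕜] {m : ℕ} {ε : DyadicInterval → 𝕜} {α : Fin m → Fin 2}
  {p : Fin m → ℝ≥0∞}

/-- Membership of `α` in `U m` forces `m > 0`, which excludes `r = ∞`; the bounds `p j ≥ 1` exclude
`r = 0`. -/
theorem exponent_spec (hα : α ∈ U m) (hp : ∀ j, 1 ≤ p j ∧ p j < ∞) {r : ℝ≥0∞}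
    (hr : ∑ j, 1 / p j = 1 / r) :
    r ≠ 0 ∧ r ≠ ∞ ∧ ∑ j, r.toReal / (p j).toReal = 1 := by
  have hp0 : ∀ j, p j ≠ 0 := fun j => (lt_of_lt_of_le one_pos (hp j).1).ne'
  have hr0 : r ≠ 0 := by
    rintro rfl
    have : ∑ j, 1 / p j < ∞ := ENNReal.sum_lt_top.2 fun j _ => by
      simpa using pos_iff_ne_zero.2 (hp0 j)
    rw [hr] at this
    simp at this
  obtain ⟨i, _⟩ := Finset.card_pos.1 (sigma_pos hα)
  have hr' : r ≠ ∞ := by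
    rintro rfl
    rw [ENNReal.div_top, Finset.sum_eq_zero_iff] at hr
    have := hr i (Finset.mem_univ i)
    simp [(hp i).2.ne] at this
  refine ⟨hr0, hr', ?_⟩
  have h := congrArg ENNReal.toReal hr
  rw [ENNReal.toReal_sum fun j _ => by simpa using hp0 j] at h
  simp only [ENNReal.toReal_div, ENNReal.toReal_one] at h
  have hrr := ENNReal.toReal_pos hr0 hr'
  calc ∑ j, r.toReal / (p j).toReal = r.toReal * ∑ j, 1 / (p j).toReal := by
        rw [Finset.mul_sum]; exact Finset.sum_congr rfl fun j _ => by ring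
    _ = 1 := by rw [h]; field_simp

theorem norm_le_symbolNorm (h : symbolNorm ε < ∞) (I : DyadicInterval) :
    ‖ε I‖ ≤ (symbolNorm ε).toReal := by
  rw [← toReal_enorm]
  exact ENNReal.toReal_mono h.ne (le_iSup (fun I => ‖ε I‖ₑ) I)

theorem weakNorm_le_of_isHaarMultiplier {f : Fin m → ℝ → 𝕜} {g : ℝ → 𝕜} {r : ℝ≥0∞}
    (hr : 0 < r.toReal) (hg : IsHaarMultiplier ε α f g) {C : ℝ≥0} {A : ℝ≥0∞}
    (h : ∀ (F : Finset DyadicInterval) (s : ℝ), 0 < s → ENNReal.ofReal s ^ r.toReal *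
      volume {x | s < ‖∑ I ∈ F, haarTerm ε α f I x‖} ≤ C * A ^ r.toReal) :
    weakNorm g r ≤ (2 * C ^ (1 / r.toReal) : ℝ≥0) * A := by
  refine iSup_le fun t => ?_
  rcases t.2.eq_or_lt with ht | ht
  · have : t = 0 := Subtype.ext ht.symm
    simp [this]
  -- Where `|g| > t`, either the finite sum exceeds `t / 2` or it differs from `g` by at least `t /
  -- 2`. The second set disappears in the limit; halving the level accounts for the factor `2` in
  -- the constant.
  set s : ℝ := (t : ℝ) / 2 with hs
  have hs0 : 0 < s := half_pos ht
  have hbound : ENNReal.ofReal s ^ r.toReal * volume {x | (t : ℝ) < ‖g x‖} ≤ C * A ^ r.toReal := by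
    have hlim := tendstoInMeasure_iff_norm.1 hg s hs0
    have h2 : Tendsto (fun F : Finset DyadicInterval => C * A ^ r.toReal
        + ENNReal.ofReal s ^ r.toReal * volume {x | s ≤ ‖∑ I ∈ F, haarTerm ε α f I x - g x‖})
        atTop (nhds (C * A ^ r.toReal + ENNReal.ofReal s ^ r.toReal * 0)) :=
      tendsto_const_nhds.add (ENNReal.Tendsto.const_mul hlim
        (Or.inr (ENNReal.rpow_ne_top_of_nonneg hr.le ENNReal.ofReal_ne_top)))
    rw [mul_zero, add_zero] at h2
    refine ge_of_tendsto' h2 fun F => ?_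
    refine le_trans ?_ (add_le_add_left (h F s hs0) _)
    rw [← mul_add]
    gcongr
    refine (measure_mono fun x hx => ?_).trans (measure_union_le _ _)
    have hx' : (t : ℝ) < ‖g x‖ := hx
    by_contra hcon
    simp only [Set.mem_union, Set.mem_ofPred_eq, not_or, not_lt, not_le] at hcon
    have := norm_sub_norm_le (g x) (∑ I ∈ F, haarTerm ε α f I x)
    rw [norm_sub_rev] at this
    linarith [hcon.1, hcon.2]
  have h3 := ENNReal.rpow_le_rpow hbound (z := 1 / r.toReal) (by positivity)
  rw [ENNReal.mul_rpow_of_nonneg _ _ (by positivity), ENNReal.mul_rpow_of_nonneg _ _ (by positivity),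
    ← ENNReal.rpow_mul, ← ENNReal.rpow_mul, mul_one_div_cancel hr.ne', ENNReal.rpow_one,
    ENNReal.rpow_one] at h3
  have ht2 : (t : ℝ≥0∞) = 2 * ENNReal.ofReal s := by
    rw [← ENNReal.ofReal_coe_nnreal, ← ENNReal.ofReal_ofNat 2, ← ENNReal.ofReal_mul (by norm_num),
      hs, mul_div_cancel₀ _ (two_ne_zero)]
  rw [ht2, mul_assoc, ENNReal.coe_mul, ENNReal.coe_rpow_of_nonneg _ (by positivity), mul_assoc]
  exact mul_le_mul_right h3 _

theorem weakBounded_of_symbolNorm_lt_top (hα : α ∈ U m) (hp : ∀ j, 1 ≤ p j ∧ p j < ∞) {r : ℝ≥0∞}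
    (hr : ∑ j, 1 / p j = 1 / r) (hε : symbolNorm ε < ∞) : WeakBounded ε α p r := by
  obtain ⟨hr0, hr', hpr⟩ := exponent_spec hα hp hr
  have hrr := ENNReal.toReal_pos hr0 hr'
  have hB := norm_le_symbolNorm hε
  obtain ⟨C, hC⟩ := exists_sum_haarTerm_weak_le hα hB hp hrr hpr
  refine ⟨2 * C ^ (1 / r.toReal), fun f hf => ?_⟩
  obtain ⟨g, hg⟩ := exists_isHaarMultiplier hα hB hp hrr hpr hf
  exact ⟨g, hg, TendstoInMeasure.aestronglyMeasurable (fun F =>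
    (Finset.measurable_fun_sum F fun I _ => measurable_haarTerm ε α f I).aestronglyMeasurable) hg,
    weakNorm_le_of_isHaarMultiplier hrr hg (hC f hf)⟩

theorem strongBounded_of_symbolNorm_lt_top (hα : α ∈ U m) (hp : ∀ j, 1 < p j ∧ p j < ∞)
    {r : ℝ≥0∞} (hr : ∑ j, 1 / p j = 1 / r) (hε : symbolNorm ε < ∞) : StrongBounded ε α p r := by
  have hp' : ∀ j, 1 ≤ p j ∧ p j < ∞ := fun j => ⟨(hp j).1.le, (hp j).2⟩
  obtain ⟨hr0, hr', hpr⟩ := exponent_spec hα hp' hr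
  have hrr := ENNReal.toReal_pos hr0 hr'
  have hB := norm_le_symbolNorm hε
  obtain ⟨C₁, hC₁⟩ := exists_maximalSum_strong_le hα hB hrr
  obtain ⟨C₂, hC₂⟩ := prod_maximal_strong_le (𝕜 := 𝕜) hp hrr hpr
  refine ⟨(C₁ * C₂) ^ (1 / r.toReal), fun f hf => ?_⟩
  obtain ⟨g, hg⟩ := exists_isHaarMultiplier hα hB hp' hrr hpr hf
  have hm : ∀ F : Finset DyadicInterval, AEStronglyMeasurable
      (fun x => ∑ I ∈ F, haarTerm ε α f I x) volume := fun F =>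
    (Finset.measurable_fun_sum F fun I _ => measurable_haarTerm ε α f I).aestronglyMeasurable
  have hbound : eLpNorm g r volume
      ≤ ((C₁ * C₂) ^ (1 / r.toReal) : ℝ≥0) * ∏ j, eLpNorm (f j) (p j) volume := by
    -- Fatou's lemma for convergence in measure: the uniform bound on finite sums passes to `g`.
    refine eLpNorm_le_of_tendstoInMeasure (Eventually.of_forall fun F => ?_) hg hm
    rw [eLpNorm_eq_lintegral_rpow_enorm_toReal hr0 hr']
    have h1 : ∫⁻ x, ‖∑ I ∈ F, haarTerm ε α f I x‖ₑ ^ r.toReal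
        ≤ (C₁ * C₂ : ℝ≥0) * (∏ j, eLpNorm (f j) (p j) volume) ^ r.toReal := by
      refine (lintegral_mono fun x => ENNReal.rpow_le_rpow
        (enorm_sum_le_maximalSum _ F x) hrr.le).trans ?_
      refine (hC₁ f (fun j => integrableOn_toSet (hp' j).1 (hf j)) F).trans ?_
      rw [ENNReal.coe_mul, mul_assoc]
      gcongr
      exact hC₂ f hf
    refine (ENNReal.rpow_le_rpow h1 (by positivity)).trans (le_of_eq ?_)
    rw [ENNReal.mul_rpow_of_nonneg _ _ (by positivity), ← ENNReal.rpow_mul,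
      mul_one_div_cancel hrr.ne', ENNReal.rpow_one, ENNReal.coe_rpow_of_nonneg _ (by positivity)]
  refine ⟨g, hg, ⟨TendstoInMeasure.aestronglyMeasurable hm hg, hbound.trans_lt ?_⟩, hbound⟩
  exact ENNReal.mul_lt_top ENNReal.coe_lt_top
    (ENNReal.prod_lt_top fun j _ => (hf j).eLpNorm_lt_top)

/-- The functions that detect the symbol at `I`: `h_I` in the cancellative places and `1_I` in the
others. -/
noncomputable def testFunction (𝕜 : Type*) [RCLike 𝕜] (I : DyadicInterval) (a : Fin 2) (x : ℝ) :
    𝕜 :=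
  if a = 0 then (haar I x : 𝕜) else I.toSet.indicator (fun _ => 1) x

theorem coeff_testFunction_self (I : DyadicInterval) (a : Fin 2) :
    coeff (testFunction 𝕜 I a) I a = 1 := by
  classical
  by_cases ha : a = 0
  · subst ha
    have h := integral_haar_mul_haar I I
    rw [if_pos rfl] at h
    simp only [coeff, testFunction, if_true]
    simp_rw [← RCLike.ofReal_mul]
    rw [integral_ofReal, h, RCLike.ofReal_one]
  · obtain rfl : a = 1 := by omega
    have hI : ((I.len : ℝ) : 𝕜) ≠ 0 := by exact_mod_cast I.len_ne_zero
    rw [coeff_one]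
    simp only [testFunction, one_ne_zero, if_false]
    rw [setIntegral_indicator I.measurableSet_toSet, Set.inter_self, setIntegral_const,
      measureReal_def, volume_toSet, ENNReal.toReal_ofReal I.len_pos.le,
      RCLike.real_smul_eq_coe_mul, mul_one, inv_mul_cancel₀ hI]

theorem coeff_testFunction_of_ne {I J : DyadicInterval} (h : I ≠ J) :
    coeff (testFunction 𝕜 I 0) J 0 = 0 := by
  classical
  have h1 := integral_haar_mul_haar I J
  rw [if_neg h] at h1
  simp only [coeff, testFunction, if_true]
  simp_rw [← RCLike.ofReal_mul]
  rw [integral_ofReal, h1, RCLike.ofReal_zero]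

theorem norm_testFunction (I : DyadicInterval) (a : Fin 2) (x : ℝ) :
    ‖testFunction 𝕜 I a x‖ = ‖I.toSet.indicator
      (fun _ => if a = 0 then (Real.sqrt I.len)⁻¹ else 1) x‖ := by
  unfold testFunction
  split_ifs with ha
  · rw [RCLike.norm_ofReal, abs_haar, Real.norm_of_nonneg]
    exact Set.indicator_nonneg (fun _ _ => by positivity) x
  · by_cases hx : x ∈ I.toSet <;> simp [hx]

theorem measurable_testFunction (I : DyadicInterval) (a : Fin 2) :
    Measurable (testFunction 𝕜 I a) := by
  unfold testFunction
  split_ifs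
  · exact RCLike.measurable_ofReal.comp (measurable_haar I)
  · exact measurable_const.indicator I.measurableSet_toSet

theorem eLpNorm_testFunction (I : DyadicInterval) (a : Fin 2) {q : ℝ≥0∞} (hq : q ≠ 0)
    (hq' : q ≠ ∞) : eLpNorm (testFunction 𝕜 I a) q volume
      = ENNReal.ofReal (if a = 0 then (Real.sqrt I.len)⁻¹ else 1)
        * volume I.toSet ^ (1 / q.toReal) := by
  rw [eLpNorm_congr_norm_ae (Eventually.of_forall (norm_testFunction I a)),
    eLpNorm_indicator_const I.measurableSet_toSet hq hq', Real.enorm_of_nonneg]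
  positivity

/-- At a cancellative place the test function is `h_I`, orthogonal to all other Haar functions, so
the series collapses to the term of `I`. -/
theorem haarTerm_testFunction (hα : α ∈ U m) (I J : DyadicInterval) [Decidable (J = I)] (x : ℝ) :
    haarTerm ε α (fun j => testFunction 𝕜 I (α j)) J x
      = if J = I then ε I * (haar I x : 𝕜) ^ sigma α else 0 := by
  split_ifs with h
  · subst h
    simp [haarTerm, coeff_testFunction_self]
  · obtain ⟨i, hi⟩ := Finset.card_pos.1 (sigma_pos hα)
    have hi0 : α i = 0 := (Finset.mem_filter.1 hi).2
    rw [haarTerm, Finset.prod_eq_zero (Finset.mem_univ i), mul_zero, zero_mul]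
    rw [hi0]
    exact coeff_testFunction_of_ne (Ne.symm h)

/-- The product of the norms of the test functions is `|I| ^ (-σ(α) / 2) |I| ^ (1 / r)`, exactly the
`L^r` norm of `h_I ^ σ(α)`. Dividing by it gives `|ε_I| ≤ C` for the bound `C` of the multiplier. -/
theorem symbolNorm_lt_top_of_strongBounded (hα : α ∈ U m) (hp : ∀ j, 1 ≤ p j ∧ p j < ∞)
    {r : ℝ≥0∞} (hr : ∑ j, 1 / p j = 1 / r) (h : StrongBounded ε α p r) : symbolNorm ε < ∞ := by
  classical
  obtain ⟨hr0, hr', hpr⟩ := exponent_spec hα hp hr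
  have hrr := ENNReal.toReal_pos hr0 hr'
  have hp0 : ∀ j, p j ≠ 0 := fun j => (lt_of_lt_of_le one_pos (hp j).1).ne'
  obtain ⟨C, hC⟩ := h
  refine (iSup_le fun I => ?_ : symbolNorm ε ≤ C).trans_lt ENNReal.coe_lt_top
  have hV0 : volume I.toSet ≠ 0 := I.volume_ne_zero
  have hV1 : volume I.toSet ≠ ∞ := I.volume_ne_top
  set f : Fin m → ℝ → 𝕜 := fun j => testFunction 𝕜 I (α j) with hf
  have hfm : ∀ j, MemLp (f j) (p j) := fun j =>
    ⟨(measurable_testFunction I _).aestronglyMeasurable, by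
      rw [hf, eLpNorm_testFunction I _ (hp0 j) (hp j).2.ne]
      exact ENNReal.mul_lt_top ENNReal.ofReal_lt_top
        (ENNReal.rpow_lt_top_of_nonneg (by positivity) hV1)⟩
  obtain ⟨g, hg, -, hle⟩ := hC f hfm
  have hg' : IsHaarMultiplier ε α f fun x => ε I * (haar I x : 𝕜) ^ sigma α := by
    refine tendstoInMeasure_iff_norm.2 fun δ hδ => tendsto_const_nhds.congr' ?_
    filter_upwards [eventually_ge_atTop {I}] with F hF
    have hI : I ∈ F := hF (Finset.mem_singleton_self I)
    have : ∀ x, ∑ J ∈ F, haarTerm ε α f J x = ε I * (haar I x : 𝕜) ^ sigma α := by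
      intro x
      simp_rw [hf, haarTerm_testFunction hα]
      rw [Finset.sum_ite_eq', if_pos hI]
    simp [this, not_le.2 hδ]
  have hae := tendstoInMeasure_ae_unique hg hg'
  have hnorm : ∀ x, ‖ε I * (haar I x : 𝕜) ^ sigma α‖ = ‖I.toSet.indicator
      (fun _ => ‖ε I‖ * (Real.sqrt I.len)⁻¹ ^ sigma α) x‖ := by
    intro x
    by_cases hx : x ∈ I.toSet
    · rw [Set.indicator_of_mem hx, norm_mul, norm_pow, RCLike.norm_ofReal, abs_haar_of_mem hx,
        Real.norm_of_nonneg (by positivity)]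
    · simp [hx, haar_of_notMem hx, (sigma_pos hα).ne']
  have hprod : ∏ j, eLpNorm (f j) (p j) volume
      = ENNReal.ofReal ((Real.sqrt I.len)⁻¹ ^ sigma α) * volume I.toSet ^ (1 / r.toReal) := by
    have hsum : ∑ j, 1 / (p j).toReal = 1 / r.toReal := by
      rw [eq_div_iff hrr.ne', Finset.sum_mul]
      refine Eq.trans (Finset.sum_congr rfl fun j _ => ?_) hpr
      ring
    simp_rw [hf, eLpNorm_testFunction I _ (hp0 _) (hp _).2.ne]
    rw [Finset.prod_mul_distrib, ← ENNReal.ofReal_prod_of_nonneg fun j _ => by positivity,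
      Finset.prod_ite, ← hsum]
    have hV : ∏ j, volume I.toSet ^ (1 / (p j).toReal)
        = volume I.toSet ^ ∑ j, 1 / (p j).toReal := by
      simp_rw [volume_toSet, ENNReal.ofReal_rpow_of_pos I.len_pos]
      rw [← ENNReal.ofReal_prod_of_nonneg fun j _ => Real.rpow_nonneg I.len_pos.le _,
        ← Real.rpow_sum_of_pos I.len_pos]
    rw [hV]
    simp [sigma]
  have hpos : 0 < (Real.sqrt I.len)⁻¹ ^ sigma α := by
    have := Real.sqrt_pos.2 I.len_pos
    positivity
  rw [eLpNorm_congr_ae hae, eLpNorm_congr_norm_ae (Eventually.of_forall hnorm),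
    eLpNorm_indicator_const I.measurableSet_toSet hr0 hr', hprod,
    Real.enorm_of_nonneg (by positivity), ENNReal.ofReal_mul (norm_nonneg _), ofReal_norm,
    mul_assoc] at hle
  refine (ENNReal.mul_le_mul_iff_left (c := ENNReal.ofReal ((Real.sqrt I.len)⁻¹ ^ sigma α) *
    volume I.toSet ^ (1 / r.toReal)) (mul_ne_zero (by simpa using hpos) ?_)
    (ENNReal.mul_ne_top ENNReal.ofReal_ne_top ?_)).1 hle
  · exact (ENNReal.rpow_pos hV0.bot_lt hV1).ne'
  · exact ENNReal.rpow_ne_top_of_nonneg (by positivity) hV1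

end

end MultilinearHaar

theorem theorem4p1 {𝕜 : Type*} [RCLike 𝕜] {m : ℕ} (ε : MultilinearHaar.DyadicInterval → 𝕜)
    (α : Fin m → Fin 2) (hα : α ∈ MultilinearHaar.U m)
    (p : Fin m → ℝ≥0∞) (r : ℝ≥0∞) (hr : ∑ j, 1 / p j = 1 / r) :
    ((∀ j, 1 < p j ∧ p j < ∞) →
      (MultilinearHaar.StrongBounded ε α p r ↔ MultilinearHaar.symbolNorm ε < ∞)) ∧
    ((∀ j, 1 ≤ p j ∧ p j < ∞) → MultilinearHaar.symbolNorm ε < ∞ →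
      MultilinearHaar.WeakBounded ε α p r) := by
  refine ⟨fun hp => ⟨fun h => ?_, fun h => ?_⟩, fun hp h => ?_⟩
  · exact MultilinearHaar.symbolNorm_lt_top_of_strongBounded hα
      (fun j => ⟨(hp j).1.le, (hp j).2⟩) hr h
  · exact MultilinearHaar.strongBounded_of_symbolNorm_lt_top hα hp hr h
  · exact MultilinearHaar.weakBounded_of_symbolNorm_lt_top hα hp hr h
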